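/- Let $(\mathsf X,\mathcal X)$ and $(\mathsf Y,\mathcal Y)$ be measurable spaces with $\mathcal X$ countably generated. Consider a hidden Markov model: a Markov kernel $Q$ on $\mathsf X$ and a Markov kernel $G(x,dy)=g(x,y)\,\lambda(dy)$ from $\mathsf X$ to $\mathsf Y$, where $\lambda$ is $\sigma$-finite and $g\ge 0$ is jointly measurable; write $g_y=g(\cdot,y)$. For $y_k,\dots,y_m\in\mathsf Y$ put $$L\langle y_{k:m}\rangle(x_k,A)=\int\!\cdots\!\int \mathbf 1_A(x_{m+1})\prod_{\ell=k}^m g_{y_\ell}(x_\ell)\,Q(x_\ell,dx_{\ell+1}),\qquad L\langle y_{k:m}\rangle(x,\cdot)=\delta_x\ \text{ if } k>m.$$ Write $\mu f=\int f\,d\mu$. For a probability measure $\chi$ on $\mathsf X$ define the predictor $\phi_\chi\langle y_{0:n-1}\rangle(A)=\chi L\langle y_{0:n-1}\rangle\mathbf 1_A/\chi L\langle y_{0:n-1}\rangle\mathbf 1_{\mathsf X}$ (equal to $\chi$ for $n=0$), and the filter $\bar\phi_\chi\langle y_{0:n}\rangle(A)=\phi_\chi\langle y_{0:n-1}\rangle(g_{y_n}\mathbf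 1_A)/\phi_\chi\langle y_{0:n-1}\rangle g_{y_n}$. Define $$\sigma_\chi^2\langle y_{0:n-1}\rangle(f)=\sum_{k=0}^n\phi_\chi\langle y_{0:k-1}\rangle\left(\frac{L\langle y_{k:n-1}\rangle f-\phi_\chi\langle y_{0:n-1}\rangle f\cdot L\langle y_{k:n-1}\rangle\mathbf 1_{\mathsf X}}{\phi_\chi\langle y_{0:k-1}\rangle L\langle y_{k:n-1}\rangle\mathbf 1_{\mathsf X}}\right)^{2},$$ $$\tilde\sigma_\chi^2\langle y_{0:n}\rangle(h)=\frac{\sigma_\chi^2\langle y_{0:n-1}\rangle\big(g_{y_n}\{h-\bar\phi_\chi\langle y_{0:n}\rangle h\}\big)}{\big(\phi_\chi\langle y_{0:n-1}\rangle g_{y_n}\big)^2},\qquad \tilde\sigma_\chi=\sqrt{\tilde\sigma_\chi^2}.$$ Let $(Y_n)_{n\in\mathbb N}$ be a stationary $\mathsf Y$-valued sequence on a probability space $(\Omega,\mathcal A,\mathbb P)$. On the same space let, for each $N\ge1$, $(\xi_n^{N,i})_{n\in\mathbb N,\,1\le i\le N}$ be the particles of the bootstrap particle filter run on $(Y_n)$: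 conditionally on $(Y_m)_{m\in\mathbb N}$ the initial particles $\xi_0^{N,1},\dots,\xi_0^{N,N}$ are i.i.d. from $\chi$, and conditionally on $(Y_m)_{m\in\mathbb N}$ and all particles up to time $n$, the particles $\xi_{n+1}^{N,1},\dots,\xi_{n+1}^{N,N}$ are i.i.d. from $\sum_{i=1}^N\frac{g(\xi_n^{N,i},Y_n)}{\sum_{j}g(\xi_n^{N,j},Y_n)}Q(\xi_n^{N,i},\cdot)$. The particle filter approximation is $\bar\phi_\chi^N\langle Y_{0:n}\rangle=\sum_{i=1}^N\frac{g(\xi_n^{N,i},Y_n)}{\sum_{j}g(\xi_n^{N,j},Y_n)}\delta_{\xi_n^{N,i}}$. **Theorem.** Assume (A2): $g(x,y)>0$ for all $(x,y)\in\mathsf X\times\mathsf Y$, and $\mathbb E[\ln^+\|g_{Y_0}\|_\infty]<\infty$. Then for every bounded measurable $h:\mathsf X\to\mathbb R$, every real $p>0$, every probability measure $\chi$ on $\mathsf X$ and every $n\in\mathbb N$, $\mathbb P$-almost surely, $$\lim_{N\to\infty}\sqrt N\;\mathbb E\Big[\big|\bar\phi^N_\chi\langle Y_{0:n}\rangle h-\bar\phi_\chi\langle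 Y_{0:n}\rangle h\big|^p\,\Big|\,Y_{0:n}\Big]^{1/p}=\sqrt2\;\tilde\sigma_\chi\langle Y_{0:n}\rangle(h)\left(\frac{\Gamma((p+1)/2)}{\sqrt{\pi}}\right)^{1/p}.$$ -/

import Mathlib

open MeasureTheory ProbabilityTheory Filter
open scoped ENNReal Topology

noncomputable section

/-- A hidden Markov model on the state space `X` and the observation space `Y`: the transition kernel
`Q` of the hidden chain, the observation kernel `G`, and a density `g` of `G` with respect to a
σ-finite reference measure. The initial distribution is kept separate. -/
structure HiddenMarkovModel (X Y : Type*) [MeasurableSpace X] [MeasurableSpace Y] where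
  Q : Kernel X X
  markov_Q : IsMarkovKernel Q
  G : Kernel X Y
  markov_G : IsMarkovKernel G
  ref : Measure Y
  sigmaFinite_ref : SigmaFinite ref
  g : X → Y → ℝ
  measurable_g : Measurable (Function.uncurry g)
  g_nonneg : ∀ x y, 0 ≤ g x y
  G_eq : ∀ x, G x = ref.withDensity (fun y => ENNReal.ofReal (g x y))

attribute [instance] HiddenMarkovModel.markov_Q HiddenMarkovModel.markov_G
  HiddenMarkovModel.sigmaFinite_ref

namespace HiddenMarkovModel

variable {X Y : Type*} [MeasurableSpace X] [MeasurableSpace Y] (M : HiddenMarkovModel X Y)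

/-- The one-step unnormalized kernel `L⟨y⟩(x, dx') = g(x, y) Q(x, dx')`. -/
def stepKernel (y : Y) : Kernel X X :=
  Kernel.withDensity M.Q (fun x _ => ENNReal.ofReal (M.g x y))

/-- The unnormalized kernel `L⟨y_k, …, y_{n-1}⟩`; it is the identity kernel `δ_x` if `n ≤ k`. -/
def lkh (y : ℕ → Y) (k : ℕ) : ℕ → Kernel X X
  | 0 => Kernel.id
  | n + 1 => if k ≤ n then M.stepKernel (y n) ∘ₖ lkh y k n else Kernel.id

/-- The function `L⟨y_k, …, y_{n-1}⟩ f`. -/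
def lkhFun (y : ℕ → Y) (k n : ℕ) (f : X → ℝ) (x : X) : ℝ :=
  ∫ x', f x' ∂(M.lkh y k n x)

/-- The predictor `φ_χ⟨y_0, …, y_{n-1}⟩ = χ L⟨y_{0:n-1}⟩ / χ L⟨y_{0:n-1}⟩ 1`. -/
def pred (χ : Measure X) (y : ℕ → Y) (n : ℕ) : Measure X :=
  ((χ.bind (M.lkh y 0 n)) Set.univ)⁻¹ • χ.bind (M.lkh y 0 n)

/-- The updating step: the measure `μ` reweighted by `g(·, y)` and normalized. -/
def update (y : Y) (μ : Measure X) : Measure X :=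
  (∫⁻ x, ENNReal.ofReal (M.g x y) ∂μ)⁻¹ • μ.withDensity (fun x => ENNReal.ofReal (M.g x y))

/-- Updating followed by prediction: one step of the predictor recursion. -/
def feynmanKac (y : Y) (μ : Measure X) : Measure X :=
  (M.update y μ).bind M.Q

/-- The filter `φ̄_χ⟨y_0, …, y_n⟩`. -/
def filt (χ : Measure X) (y : ℕ → Y) (n : ℕ) : Measure X :=
  M.update (y n) (M.pred χ y n)

/-- The asymptotic variance `σ²_χ⟨y_0, …, y_{n-1}⟩(f)` of the particle predictor. -/
def predVariance (χ : Measure X) (y : ℕ → Y) (n : ℕ) (f : X → ℝ) : ℝ :=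
  ∑ k ∈ Finset.range (n + 1),
    ∫ x, ((M.lkhFun y k n f x - (∫ x', f x' ∂(M.pred χ y n)) * M.lkhFun y k n (fun _ => 1) x) /
        (∫ x', M.lkhFun y k n (fun _ => 1) x' ∂(M.pred χ y k))) ^ 2 ∂(M.pred χ y k)

/-- The asymptotic variance `σ̃²_χ⟨y_0, …, y_n⟩(h)` of the particle filter. -/
def filtVariance (χ : Measure X) (y : ℕ → Y) (n : ℕ) (h : X → ℝ) : ℝ :=
  M.predVariance χ y n (fun x => M.g x (y n) * (h x - ∫ x', h x' ∂(M.filt χ y n))) /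
    (∫ x, M.g x (y n) ∂(M.pred χ y n)) ^ 2

/-- The empirical measure of `N` points. -/
def empirical {N : ℕ} (x : Fin N → X) : Measure X :=
  (N : ℝ≥0∞)⁻¹ • ∑ i, Measure.dirac (x i)

/-- The particle filter approximation, that is, the weighted empirical measure
`∑ᵢ (ωᵢ / ∑ⱼ ωⱼ) δ_{xᵢ}` with `ωᵢ = g(xᵢ, y)`. -/
def partFilt {N : ℕ} (y : Y) (x : Fin N → X) : Measure X :=
  M.update y (empirical x)

/-- The supremum norm of the local likelihood `g(·, y)`, as an extended nonnegative number. -/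
def supLikelihood (y : Y) : ℝ≥0∞ := ⨆ x, ENNReal.ofReal (M.g x y)

variable {Ω : Type*} [MeasurableSpace Ω]

/-- `ξ n i` is the `i`-th particle at time `n` of a bootstrap particle filter with `N` particles, run
on the observations `obs` with initial distribution `χ`: given the observations, the initial particles
are i.i.d. from `χ`; given the observations and the particles up to time `n`, the particles at time
`n + 1` are i.i.d. from the mixture `∑ᵢ (ωᵢ / ∑ⱼ ωⱼ) Q(ξ n i, ·)`. -/
structure IsBootstrapFilter (χ : Measure X) (P : Measure Ω) (obs : ℕ → Ω → Y) (N : ℕ)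
    (ξ : ℕ → Fin N → Ω → X) : Prop where
  measurable_particle : ∀ n i, Measurable (ξ n i)
  init : ∀ A : Fin N → Set X, (∀ i, MeasurableSet (A i)) →
    P[Set.indicator {ω | ∀ i, ξ 0 i ω ∈ A i} (fun _ => (1 : ℝ)) |
        MeasurableSpace.comap (fun ω k => obs k ω) inferInstance]
      =ᵐ[P] fun _ => ∏ i, χ.real (A i)
  step : ∀ n, ∀ A : Fin N → Set X, (∀ i, MeasurableSet (A i)) →
    P[Set.indicator {ω | ∀ i, ξ (n + 1) i ω ∈ A i} (fun _ => (1 : ℝ)) |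
        MeasurableSpace.comap (fun ω k => obs k ω) inferInstance ⊔
          MeasurableSpace.comap (fun ω (m : Fin (n + 1)) i => ξ m i ω) inferInstance]
      =ᵐ[P] fun ω => ∏ i, (M.feynmanKac (obs n ω) (empirical fun j => ξ n j ω)).real (A i)

/-- Assumption on the likelihood and the law of `Y_0`: `g` is positive everywhere and
`E[ln⁺ ‖g(·, Y_0)‖_∞] < ∞`. -/
structure LikelihoodAssumption (P : Measure Ω) (obs : ℕ → Ω → Y) : Prop where
  pos : ∀ x y, 0 < M.g x y
  aemeasurable_sup : AEMeasurable M.supLikelihood (P.map (obs 0))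
  lintegral_log_lt_top :
    ∫⁻ y, (ENNReal.log (M.supLikelihood y)).toENNReal ∂(P.map (obs 0)) < ∞

end HiddenMarkovModel

/-- A (strictly) stationary sequence of random variables. -/
structure IsStationarySeq {Y Ω : Type*} [MeasurableSpace Y] [MeasurableSpace Ω] (P : Measure Ω)
    (obs : ℕ → Ω → Y) : Prop where
  measurable_obs : ∀ n, Measurable (obs n)
  shift_eq : ∀ m, P.map (fun ω k => obs (k + m) ω) = P.map (fun ω k => obs k ω)

end

/-!
Freeze the observations. One step of the particle filter makes an error that splits into two parts:
given the current particles, the new particles are independent samples, and the mean of `f` under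
their common law differs from its limit by the filter error of `Q f` at the current time. The filter
error in turn is a ratio of integrals against the empirical measure, equal to first order to the
predictor error of `g (f - φ̄ f)` divided by `φ g`. Hence asymptotic normality propagates along time
once the central limit theorem for the fresh samples holds uniformly in their common law, which a
second-order expansion of the characteristic function gives as soon as the variances converge in
mean. The resulting recursion for the variances is the one satisfied by `predVariance` and
`filtVariance`.

Exponential moments of the rescaled errors stay bounded in `N`, by Hoeffding's lemma, and this
turns the convergence in law into convergence of all absolute moments. Finally, the conditional
expectation given `Y₀, …, Yₙ` is the integral against the law of the particles along the frozen
observations.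
-/

section ElementaryEstimates

open scoped Real Complex

lemma norm_cexp_mul_I_sub_le (x y : ℝ) :
    ‖cexp (x * Complex.I) - cexp (y * Complex.I)‖ ≤ |x - y| := by
  have factor : cexp (x * Complex.I) - cexp (y * Complex.I) =
      cexp (y * Complex.I) * (cexp (Complex.I * (x - y : ℝ)) - 1) := by
    rw [mul_sub, ← Complex.exp_add, mul_one]
    congr 2
    push_cast
    ring
  rw [factor, norm_mul, Complex.norm_exp_ofReal_mul_I, one_mul]
  exact Real.norm_exp_I_mul_ofReal_sub_one_le

lemma norm_cexp_mul_I_sub_taylor_le (x : ℝ) :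
    ‖cexp (x * Complex.I) - (1 + x * Complex.I - x ^ 2 / 2)‖ ≤ 4 * |x| ^ 3 := by
  rcases le_total |x| 1 with hx | hx
  · have taylor : ∑ m ∈ Finset.range 3, (x * Complex.I) ^ m / (m.factorial : ℂ) =
        1 + x * Complex.I - x ^ 2 / 2 := by
      simp [Finset.sum_range_succ, mul_pow]
      ring
    have remainder := Complex.norm_exp_sub_sum_le_norm_mul_exp (x * Complex.I) 3
    rw [taylor, norm_mul, Complex.norm_real, Complex.norm_I, mul_one, Real.norm_eq_abs] at remainder
    have exp_le : rexp |x| ≤ 4 := by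
      have := Real.exp_one_lt_d9
      have := Real.exp_le_exp.2 hx
      linarith
    calc _ ≤ |x| ^ 3 * rexp |x| := remainder
      _ ≤ |x| ^ 3 * 4 := by gcongr
      _ = 4 * |x| ^ 3 := mul_comm _ _
  · have polynomial_le : ‖(1 + x * Complex.I - x ^ 2 / 2 : ℂ)‖ ≤ 1 + |x| + |x| ^ 2 / 2 := by
      refine (norm_sub_le _ _).trans (add_le_add ((norm_add_le _ _).trans ?_) ?_) <;> simp
    refine (norm_sub_le _ _).trans ?_
    rw [Complex.norm_exp_ofReal_mul_I]
    nlinarith [mul_nonneg (sub_nonneg.2 hx) (sq_nonneg |x|),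
      mul_nonneg (sub_nonneg.2 hx) (abs_nonneg x)]

lemma abs_exp_neg_sub_one_sub_le {w : ℝ} (hw : 0 ≤ w) : |rexp (-w) - (1 - w)| ≤ w ^ 2 := by
  have lower := Real.one_sub_le_exp_neg w
  have upper : rexp (-w) ≤ 1 / (1 + w) := by
    rw [Real.exp_neg, ← one_div]
    have := Real.add_one_le_exp w
    gcongr
    linarith
  have : 1 / (1 + w) - (1 - w) ≤ w ^ 2 := by
    have : 1 / (1 + w) - (1 - w) = w ^ 2 / (1 + w) := by field_simp; ring
    rw [this]
    exact div_le_self (sq_nonneg w) (by linarith)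
  rw [abs_le]
  constructor <;> nlinarith [sq_nonneg w]

lemma abs_exp_neg_sub_exp_neg_le {a b : ℝ} (ha : 0 ≤ a) (hb : 0 ≤ b) :
    |rexp (-a) - rexp (-b)| ≤ |a - b| := by
  wlog hab : a ≤ b generalizing a b
  · rw [abs_sub_comm, abs_sub_comm a]
    exact this hb ha (le_of_not_ge hab)
  have factor : rexp (-a) - rexp (-b) = rexp (-a) * (1 - rexp (-(b - a))) := by
    rw [mul_sub, ← Real.exp_add]
    ring_nf
  have := Real.one_sub_le_exp_neg (b - a)
  have : rexp (-(b - a)) ≤ 1 := Real.exp_le_one_iff.2 (by linarith)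
  have : rexp (-a) ≤ 1 := Real.exp_le_one_iff.2 (by linarith)
  rw [factor, abs_mul, Real.abs_exp, abs_of_nonneg (by linarith), abs_of_nonpos (by linarith)]
  nlinarith [Real.exp_pos (-a)]

lemma norm_pow_sub_pow_le {a b : ℂ} (ha : ‖a‖ ≤ 1) (hb : ‖b‖ ≤ 1) (n : ℕ) :
    ‖a ^ n - b ^ n‖ ≤ n * ‖a - b‖ := by
  induction n with
  | zero => simp
  | succ n ih =>
    calc ‖a ^ (n + 1) - b ^ (n + 1)‖
        = ‖a ^ n * (a - b) + (a ^ n - b ^ n) * b‖ := by ring_nf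
      _ ≤ ‖a‖ ^ n * ‖a - b‖ + ‖a ^ n - b ^ n‖ * ‖b‖ := by
        simpa only [norm_mul, norm_pow] using norm_add_le (a ^ n * (a - b)) ((a ^ n - b ^ n) * b)
      _ ≤ 1 * ‖a - b‖ + n * ‖a - b‖ * 1 := by
        gcongr
        exact pow_le_one₀ (norm_nonneg _) ha
      _ = (n + 1 : ℕ) * ‖a - b‖ := by push_cast; ring

lemma exp_add_le_half_add (a b : ℝ) : rexp (a + b) ≤ (rexp (2 * a) + rexp (2 * b)) / 2 := by
  rw [two_mul, two_mul, Real.exp_add, Real.exp_add, Real.exp_add]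
  nlinarith [sq_nonneg (rexp a - rexp b)]

end ElementaryEstimates

lemma abs_integral_le_of_forall_abs_le {α : Type*} [MeasurableSpace α] {f : α → ℝ} {C : ℝ}
    (hC : ∀ x, |f x| ≤ C) (μ : Measure α) [IsProbabilityMeasure μ] : |∫ x, f x ∂μ| ≤ C := by
  simpa using norm_integral_le_of_norm_le_const (μ := μ) (f := f) (ae_of_all _ hC)

lemma integrable_cexp_mul_I {α : Type*} [MeasurableSpace α] {μ : Measure α} [IsFiniteMeasure μ]
    {f : α → ℝ} (hf : AEMeasurable f μ) :
    Integrable (fun x => Complex.exp (f x * Complex.I)) μ :=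
  .of_bound (by fun_prop) 1 (ae_of_all _ fun x => (Complex.norm_exp_ofReal_mul_I _).le)

/-- A bounded measurable real function: the class of test functions of the central limit theorems
below. -/
structure BddMeasurable {α : Type*} [MeasurableSpace α] (f : α → ℝ) : Prop where
  measurable : Measurable f
  bounded : ∃ C, ∀ x, |f x| ≤ C

namespace BddMeasurable

variable {α β : Type*} [MeasurableSpace α] [MeasurableSpace β] {f g : α → ℝ}

lemma exists_nonneg_bound (hf : BddMeasurable f) : ∃ C, 0 ≤ C ∧ ∀ x, |f x| ≤ C :=
  let ⟨C, hC⟩ := hf.bounded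
  ⟨|C|, abs_nonneg _, fun x => (hC x).trans (le_abs_self C)⟩

lemma integrable (hf : BddMeasurable f) (μ : Measure α) [IsFiniteMeasure μ] : Integrable f μ :=
  let ⟨C, hC⟩ := hf.bounded
  .of_bound hf.measurable.aestronglyMeasurable C (ae_of_all _ hC)

lemma memLp (hf : BddMeasurable f) (q : ℝ≥0∞) (μ : Measure α) [IsFiniteMeasure μ] : MemLp f q μ :=
  let ⟨C, hC⟩ := hf.bounded
  .of_bound hf.measurable.aestronglyMeasurable C (ae_of_all _ hC)

lemma const (c : ℝ) : BddMeasurable fun _ : α => c := ⟨measurable_const, |c|, fun _ => le_rfl⟩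

lemma add (hf : BddMeasurable f) (hg : BddMeasurable g) : BddMeasurable fun x => f x + g x := by
  obtain ⟨C, hC⟩ := hf.bounded
  obtain ⟨D, hD⟩ := hg.bounded
  exact ⟨hf.measurable.add hg.measurable, C + D,
    fun x => (abs_add_le _ _).trans (add_le_add (hC x) (hD x))⟩

lemma mul (hf : BddMeasurable f) (hg : BddMeasurable g) : BddMeasurable fun x => f x * g x := by
  obtain ⟨C, hC0, hC⟩ := hf.exists_nonneg_bound
  obtain ⟨D, hD⟩ := hg.bounded
  refine ⟨hf.measurable.mul hg.measurable, C * D, fun x => ?_⟩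
  rw [abs_mul]
  exact mul_le_mul (hC x) (hD x) (abs_nonneg _) hC0

lemma const_mul (hf : BddMeasurable f) (c : ℝ) : BddMeasurable fun x => c * f x :=
  (const c).mul hf

lemma sub (hf : BddMeasurable f) (hg : BddMeasurable g) : BddMeasurable fun x => f x - g x := by
  simpa only [sub_eq_add_neg, neg_one_mul] using hf.add (hg.const_mul (-1))

lemma pow (hf : BddMeasurable f) (k : ℕ) : BddMeasurable fun x => f x ^ k := by
  obtain ⟨C, -, hC⟩ := hf.exists_nonneg_bound
  refine ⟨hf.measurable.pow_const k, C ^ k, fun x => ?_⟩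
  rw [abs_pow]
  gcongr
  exact hC x

lemma abs (hf : BddMeasurable f) : BddMeasurable fun x => |f x| :=
  let ⟨C, hC⟩ := hf.bounded
  ⟨hf.measurable.abs, C, fun x => by simpa using hC x⟩

lemma exp (hf : BddMeasurable f) : BddMeasurable fun x => Real.exp (f x) := by
  obtain ⟨C, hC⟩ := hf.bounded
  refine ⟨Real.measurable_exp.comp hf.measurable, Real.exp C, fun x => ?_⟩
  rw [Real.abs_exp]
  exact Real.exp_le_exp.2 ((le_abs_self _).trans (hC x))

lemma comp (hf : BddMeasurable f) {φ : β → α} (hφ : Measurable φ) :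
    BddMeasurable fun x => f (φ x) :=
  let ⟨C, hC⟩ := hf.bounded
  ⟨hf.measurable.comp hφ, C, fun _ => hC _⟩

lemma abs_rpow (hf : BddMeasurable f) {p : ℝ} (hp : 0 ≤ p) :
    BddMeasurable fun x => |f x| ^ p := by
  obtain ⟨C, hC⟩ := hf.bounded
  refine ⟨hf.measurable.abs.pow_const p, C ^ p, fun x => ?_⟩
  rw [abs_of_nonneg (by positivity)]
  gcongr
  exact hC x

lemma kernel_integral (hf : BddMeasurable f) (κ : Kernel β α) [IsFiniteKernel κ] :
    BddMeasurable fun x => ∫ x', f x' ∂(κ x) := by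
  obtain ⟨C, hC0, hC⟩ := hf.exists_nonneg_bound
  refine ⟨hf.measurable.stronglyMeasurable.integral_kernel.measurable, C * κ.bound.toReal,
    fun x => ?_⟩
  calc |∫ x', f x' ∂(κ x)| ≤ C * (κ x).real Set.univ :=
        norm_integral_le_of_norm_le_const (f := f) (ae_of_all _ hC)
    _ ≤ C * κ.bound.toReal := by
        gcongr
        exact ENNReal.toReal_mono κ.bound_lt_top.ne (κ.measure_le_bound x _)

lemma kernel_integral_prodMk {Φ : β × α → ℝ} (hΦ : BddMeasurable Φ) (κ : Kernel β α)
    [IsFiniteKernel κ] : BddMeasurable fun b => ∫ a, Φ (b, a) ∂(κ b) := by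
  have integral_id_prod (b : β) : ∫ q, Φ q ∂(Kernel.id ×ₖ κ) b = ∫ a, Φ (b, a) ∂(κ b) := by
    rw [Kernel.prod_apply, Kernel.id_apply, Measure.dirac_prod,
      integral_map measurable_prodMk_left.aemeasurable hΦ.measurable.aestronglyMeasurable]
  simpa only [integral_id_prod] using hΦ.kernel_integral (Kernel.id ×ₖ κ)

lemma integral_pos (hf : BddMeasurable f) (hpos : ∀ x, 0 < f x) (μ : Measure α)
    [IsFiniteMeasure μ] [NeZero μ] : 0 < ∫ x, f x ∂μ := by
  rw [integral_pos_iff_support_of_nonneg (fun x => (hpos x).le) (hf.integrable μ),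
    Function.support_eq_univ fun x => (hpos x).ne']
  exact Measure.measure_univ_pos.2 (NeZero.ne μ)

lemma variance_eq (hf : BddMeasurable f) (μ : Measure α) [IsProbabilityMeasure μ] :
    Var[f; μ] = ∫ x, f x ^ 2 ∂μ - (∫ x, f x ∂μ) ^ 2 :=
  variance_eq_sub (hf.memLp 2 μ)

end BddMeasurable

section EmpiricalMeasure

open HiddenMarkovModel (empirical)
open scoped Real Complex

variable {X : Type*} [MeasurableSpace X] {N : ℕ} {f : X → ℝ}

lemma integral_empirical (hf : Measurable f) (x : Fin N → X) :
    ∫ z, f z ∂empirical x = (∑ i, f (x i)) / N := by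
  rw [empirical, integral_smul_measure,
    integral_finsetSum_measure fun i _ => integrable_dirac' hf.stronglyMeasurable (by simp)]
  simp [integral_dirac' _ _ hf.stronglyMeasurable, div_eq_inv_mul]

lemma lintegral_empirical {F : X → ℝ≥0∞} (hF : Measurable F) (x : Fin N → X) :
    ∫⁻ z, F z ∂empirical x = (N : ℝ≥0∞)⁻¹ * ∑ i, F (x i) := by
  simp [empirical, lintegral_finsetSum_measure, lintegral_dirac' _ hF]

lemma measurable_empirical : Measurable (empirical : (Fin N → X) → Measure X) := by
  refine Measure.measurable_of_measurable_coe _ fun A hA => ?_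
  have apply_eq (x : Fin N → X) :
      empirical x A = (N : ℝ≥0∞)⁻¹ * ∑ i, A.indicator 1 (x i) := by
    rw [← lintegral_empirical (measurable_one.indicator hA), lintegral_indicator_one hA]
  simp_rw [apply_eq]
  exact (Finset.measurable_fun_sum _ fun i _ =>
    (measurable_one.indicator hA).comp (measurable_pi_apply i)).const_mul _

/-- The empirical measure of the sample as a Markov kernel. -/
noncomputable def empiricalKernel (X : Type*) [MeasurableSpace X] (N : ℕ) :
    Kernel (Fin N → X) X :=
  ⟨empirical, measurable_empirical⟩

variable [NeZero N]

instance (x : Fin N → X) : IsProbabilityMeasure (empirical x) := by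
  refine ⟨?_⟩
  rw [← lintegral_one, lintegral_empirical measurable_const]
  simp [ENNReal.inv_mul_cancel (NeZero.ne (N : ℝ≥0∞))]

instance : IsMarkovKernel (empiricalKernel X N) :=
  ⟨fun x => inferInstanceAs (IsProbabilityMeasure (empirical x))⟩

/-- The rescaled sampling error `√N (empirical mean of f - ν f)` of a sample `x` compared with a
measure `ν`, which need not be the law the sample is drawn from. -/
noncomputable def empErr (ν : Measure X) (f : X → ℝ) (x : Fin N → X) : ℝ :=
  √N * (∫ z, f z ∂empirical x - ∫ z, f z ∂ν)

lemma BddMeasurable.empErr (hf : BddMeasurable f) (ν : Measure X) :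
    BddMeasurable (empErr (N := N) ν f) :=
  ((hf.kernel_integral (empiricalKernel X N)).sub (.const _)).const_mul _

lemma empErr_eq_sum (hf : Measurable f) (ν : Measure X) (x : Fin N → X) :
    empErr ν f x = ∑ i, (f (x i) - ∫ z, f z ∂ν) / √N := by
  have hN : (0 : ℝ) < N := mod_cast Nat.pos_of_neZero N
  have hsq : √(N : ℝ) * √N = N := Real.mul_self_sqrt hN.le
  have hne : √(N : ℝ) ≠ 0 := (Real.sqrt_pos.2 hN).ne'
  rw [empErr, integral_empirical hf, ← Finset.sum_div, Finset.sum_sub_distrib]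
  simp only [Finset.sum_const, Finset.card_univ, Fintype.card_fin, nsmul_eq_mul]
  rw [eq_div_iff hne, mul_right_comm, hsq, mul_sub, mul_div_cancel₀ _ hN.ne']

lemma integral_cexp_mul_empErr_eq_pow (hf : Measurable f) (ν : Measure X) [SigmaFinite ν] (t : ℝ) :
    ∫ x : Fin N → X, cexp ((t * empErr ν f x : ℝ) * Complex.I) ∂(Measure.pi fun _ => ν) =
      (∫ z, cexp ((t / √N * (f z - ∫ z, f z ∂ν) : ℝ) * Complex.I) ∂ν) ^ N := by
  have cexp_eq (x : Fin N → X) : cexp ((t * empErr ν f x : ℝ) * Complex.I) =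
      ∏ i, cexp ((t / √N * (f (x i) - ∫ z, f z ∂ν) : ℝ) * Complex.I) := by
    rw [empErr_eq_sum hf, ← Complex.exp_sum, ← Finset.sum_mul, ← Complex.ofReal_sum, Finset.mul_sum]
    simp only [mul_div_assoc', div_mul_eq_mul_div]
  simp_rw [cexp_eq]
  rw [integral_fintype_prod_eq_pow
    (fun z => cexp ((t / √N * (f z - ∫ z, f z ∂ν) : ℝ) * Complex.I)), Fintype.card_fin]

end EmpiricalMeasure

section IndependentSamples

open scoped Real Complex

variable {X : Type*} [MeasurableSpace X] (ν : Measure X) [IsProbabilityMeasure ν] {N : ℕ} [NeZero N]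
  {f : X → ℝ} {C : ℝ}

lemma integral_exp_mul_empErr_le (hf : Measurable f) (hC : ∀ x, |f x| ≤ C) (s : ℝ) :
    ∫ x : Fin N → X, rexp (s * empErr ν f x) ∂(Measure.pi fun _ => ν) ≤
      rexp (C ^ 2 * s ^ 2 / 2) := by
  have hN : (0 : ℝ) < N := mod_cast Nat.pos_of_neZero N
  have exp_eq (x : Fin N → X) : rexp (s * empErr ν f x) =
      ∏ i, rexp (s / √N * (f (x i) - ∫ z, f z ∂ν)) := by
    rw [empErr_eq_sum hf, Finset.mul_sum, Real.exp_sum]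
    simp only [mul_div_assoc', div_mul_eq_mul_div]
  have hoeffding := (hasSubgaussianMGF_of_mem_Icc (μ := ν) (a := -C) (b := C) hf.aemeasurable
    (ae_of_all _ fun x => abs_le.1 (hC x))).mgf_le (s / √N)
  simp_rw [exp_eq]
  rw [integral_fintype_prod_eq_pow (fun z => rexp (s / √N * (f z - ∫ z, f z ∂ν))),
    Fintype.card_fin]
  calc _ ≤ rexp ((((‖C - -C‖₊ / 2) ^ 2 : NNReal) : ℝ) * (s / √N) ^ 2 / 2) ^ N := by
        rw [mgf] at hoeffding
        gcongr
    _ = rexp (C ^ 2 * s ^ 2 / 2) := by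
      rw [← Real.exp_nat_mul]
      congr 1
      push_cast
      rw [div_pow s, Real.sq_sqrt hN.le, div_pow, Real.norm_eq_abs, sq_abs]
      field_simp
      ring

lemma integral_exp_mul_abs_empErr_le (hf : Measurable f) (hC : ∀ x, |f x| ≤ C) (s : ℝ) :
    ∫ x : Fin N → X, rexp (s * |empErr ν f x|) ∂(Measure.pi fun _ => ν) ≤
      2 * rexp (C ^ 2 * s ^ 2 / 2) := by
  have herr : BddMeasurable (empErr (N := N) ν f) := BddMeasurable.empErr ⟨hf, C, hC⟩ ν
  have hint (r : ℝ) := (herr.const_mul r).exp.integrable (Measure.pi fun _ => ν)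
  have hle (x : Fin N → X) :
      rexp (s * |empErr ν f x|) ≤ rexp (s * empErr ν f x) + rexp (-s * empErr ν f x) := by
    rcases abs_choice (empErr ν f x) with h | h <;> rw [h]
    · linarith [Real.exp_pos (-s * empErr ν f x)]
    · rw [mul_neg, neg_mul]
      linarith [Real.exp_pos (s * empErr ν f x)]
  calc _ ≤ ∫ x : Fin N → X, (rexp (s * empErr ν f x) + rexp (-s * empErr ν f x))
        ∂(Measure.pi fun _ => ν) :=
      integral_mono ((herr.abs.const_mul s).exp.integrable _) ((hint s).add (hint (-s))) hle
    _ ≤ rexp (C ^ 2 * s ^ 2 / 2) + rexp (C ^ 2 * (-s) ^ 2 / 2) := by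
      rw [integral_add (hint s) (hint (-s))]
      exact add_le_add (integral_exp_mul_empErr_le ν hf hC s)
        (integral_exp_mul_empErr_le ν hf hC (-s))
    _ = 2 * rexp (C ^ 2 * s ^ 2 / 2) := by rw [neg_sq, two_mul]

lemma norm_integral_cexp_sub_one_sub_variance_le (hf : Measurable f) (hC : ∀ x, |f x| ≤ C)
    (hcentred : ∫ x, f x ∂ν = 0) (u : ℝ) :
    ‖∫ x, cexp ((u * f x : ℝ) * Complex.I) ∂ν - (1 - u ^ 2 * Var[f; ν] / 2 : ℝ)‖ ≤
      4 * (|u| * C) ^ 3 := by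
  have hfb : BddMeasurable f := ⟨hf, C, hC⟩
  have hlin : Integrable (fun x => ((u * f x : ℝ) : ℂ)) ν := ((hfb.const_mul u).integrable ν).ofReal
  have hquad : Integrable (fun x => (((u * f x) ^ 2 : ℝ) : ℂ)) ν :=
    (((hfb.const_mul u).pow 2).integrable ν).ofReal
  have haffine : Integrable (fun x => 1 + ((u * f x : ℝ) : ℂ) * Complex.I) ν :=
    (integrable_const _).add (hlin.mul_const _)
  have hpoly : ∫ x, (1 + ((u * f x : ℝ) : ℂ) * Complex.I - (((u * f x) ^ 2 : ℝ) : ℂ) / 2) ∂ν =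
      (1 - u ^ 2 * Var[f; ν] / 2 : ℝ) := by
    rw [integral_sub haffine (hquad.div_const 2), integral_add (integrable_const _)
      (hlin.mul_const _), integral_mul_const, integral_div, integral_complex_ofReal,
      integral_complex_ofReal, integral_const_mul, hcentred, variance_of_integral_eq_zero
      hf.aemeasurable hcentred]
    simp_rw [mul_pow, integral_const_mul]
    simp
  rw [← hpoly, ← integral_sub (integrable_cexp_mul_I (by fun_prop))
    (by exact haffine.sub (hquad.div_const 2))]
  refine (norm_integral_le_of_norm_le_const (C := 4 * (|u| * C) ^ 3)
    (ae_of_all _ fun x => ?_)).trans (by simp)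
  rw [Complex.ofReal_pow]
  refine (norm_cexp_mul_I_sub_taylor_le _).trans ?_
  rw [abs_mul]
  gcongr
  exact hC x

lemma norm_integral_cexp_sub_exp_variance_le (hf : Measurable f) (hC : ∀ x, |f x| ≤ C)
    (hcentred : ∫ x, f x ∂ν = 0) (u : ℝ) :
    ‖∫ x, cexp ((u * f x : ℝ) * Complex.I) ∂ν - rexp (-(u ^ 2 * Var[f; ν] / 2))‖ ≤
      4 * (|u| * C) ^ 3 + ((u * C) ^ 2 / 2) ^ 2 := by
  have hvar0 : 0 ≤ Var[f; ν] := variance_nonneg f ν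
  have hvarC : Var[f; ν] ≤ C ^ 2 := by
    rw [variance_of_integral_eq_zero hf.aemeasurable hcentred]
    refine (le_abs_self _).trans (abs_integral_le_of_forall_abs_le (fun x => ?_) ν)
    rw [abs_pow]
    gcongr
    exact hC x
  refine (norm_sub_le_norm_sub_add_norm_sub _ ((1 - u ^ 2 * Var[f; ν] / 2 : ℝ) : ℂ) _).trans
    (add_le_add (norm_integral_cexp_sub_one_sub_variance_le ν hf hC hcentred u) ?_)
  rw [← Complex.ofReal_sub, Complex.norm_real, Real.norm_eq_abs, abs_sub_comm]
  refine (abs_exp_neg_sub_one_sub_le (by positivity)).trans ?_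
  rw [mul_pow u]
  gcongr

/-- The rate is uniform in the sampling law `ν`, which is what allows conditioning on random
sampling laws. -/
lemma norm_integral_cexp_empErr_sub_le (hf : Measurable f) (hC : ∀ x, |f x| ≤ C) (t : ℝ) :
    ‖∫ x : Fin N → X, cexp ((t * empErr ν f x : ℝ) * Complex.I) ∂(Measure.pi fun _ => ν) -
        rexp (-(t ^ 2 * Var[f; ν] / 2))‖ ≤
      (4 * (|t| * (2 * C)) ^ 3 + ((t * (2 * C)) ^ 2 / 2) ^ 2) / √N := by
  have hN : (0 : ℝ) < N := mod_cast Nat.pos_of_neZero N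
  have hsqrt : √(N : ℝ) ^ 2 = N := Real.sq_sqrt hN.le
  have hsqrt1 : 1 ≤ √(N : ℝ) := Real.one_le_sqrt.2 (mod_cast Nat.one_le_iff_ne_zero.2 (NeZero.ne N))
  have hfb : BddMeasurable f := ⟨hf, C, hC⟩
  set f₀ : X → ℝ := fun z => f z - ∫ z, f z ∂ν
  have hf₀C (z : X) : |f₀ z| ≤ 2 * C := by
    have := abs_sub (f z) (∫ z, f z ∂ν)
    linarith [hC z, abs_integral_le_of_forall_abs_le hC ν]
  have hcentred : ∫ z, f₀ z ∂ν = 0 := by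
    rw [integral_sub (hfb.integrable ν) (integrable_const _)]
    simp
  have : 0 ≤ C := (abs_nonneg _).trans (abs_integral_le_of_forall_abs_le hC ν)
  have exp_eq : rexp (-(t ^ 2 * Var[f; ν] / 2)) =
      rexp (-((t / √N) ^ 2 * Var[f₀; ν] / 2)) ^ N := by
    rw [← Real.exp_nat_mul, variance_sub_const hf.aestronglyMeasurable, div_pow, hsqrt]
    congr 1
    field_simp
  rw [integral_cexp_mul_empErr_eq_pow hf ν t, exp_eq, Complex.ofReal_pow]
  refine (norm_pow_sub_pow_le ?_ ?_ N).trans ?_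
  · exact (norm_integral_le_of_norm_le_const (C := 1)
      (ae_of_all _ fun x => (Complex.norm_exp_ofReal_mul_I _).le)).trans (by simp)
  · rw [Complex.norm_real, Real.norm_eq_abs, Real.abs_exp, Real.exp_le_one_iff, neg_nonpos]
    have := variance_nonneg f₀ ν
    positivity
  have hfactor := norm_integral_cexp_sub_exp_variance_le ν (hf.sub_const _) hf₀C hcentred (t / √N)
  calc _ ≤ N * (4 * (|t / √N| * (2 * C)) ^ 3 + ((t / √N * (2 * C)) ^ 2 / 2) ^ 2) := by gcongr
    _ = 4 * (|t| * (2 * C)) ^ 3 / √N + ((t * (2 * C)) ^ 2 / 2) ^ 2 / √N ^ 2 := by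
      rw [abs_div, abs_of_pos (by positivity : 0 < √(N : ℝ))]
      generalize √(N : ℝ) = r at hsqrt hsqrt1 ⊢
      rw [← hsqrt]
      field_simp
    _ ≤ _ := by
      rw [add_div]
      gcongr
      exact le_self_pow₀ hsqrt1 two_ne_zero

end IndependentSamples

lemma tendsto_div_sqrt_add_one (c : ℝ) :
    Tendsto (fun N : ℕ => c / √(N + 1 : ℕ)) atTop (𝓝 0) :=
  tendsto_const_nhds.div_atTop (Real.tendsto_sqrt_atTop.comp
    (tendsto_natCast_atTop_atTop.comp (tendsto_add_atTop_nat 1)))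

section AsymptoticNotions

open scoped Real Complex

variable {α : ℕ → Type*} [∀ N, MeasurableSpace (α N)] {μ : ∀ N, Measure (α N)}
  {U V W W' : ∀ N, α N → ℝ}

/-- The random variables `W N` have exponential moments of every order, bounded uniformly in `N`.
Integrability is part of the notion, so that the bounds are not about junk integrals. -/
def HasBddExpMoments (μ : ∀ N, Measure (α N)) (W : ∀ N, α N → ℝ) : Prop :=
  ∀ s : ℝ, ∃ K, ∀ N, Integrable (fun x => rexp (s * |W N x|)) (μ N) ∧
    ∫ x, rexp (s * |W N x|) ∂μ N ≤ K

/-- The random variables `W N` converge in law to the centred Gaussian distribution of variance `v`,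
expressed through characteristic functions. -/
def IsAsympNormal (μ : ∀ N, Measure (α N)) (W : ∀ N, α N → ℝ) (v : ℝ) : Prop :=
  ∀ t : ℝ, Tendsto (fun N => ∫ x, cexp ((t * W N x : ℝ) * Complex.I) ∂μ N) atTop
    (𝓝 (rexp (-(t ^ 2 * v / 2)) : ℝ))

namespace HasBddExpMoments

lemma of_abs_le_add (hU : HasBddExpMoments μ U) (hV : HasBddExpMoments μ V)
    (hW : ∀ N, AEMeasurable (W N) (μ N)) {a b : ℝ}
    (hle : ∀ N x, |W N x| ≤ a * |U N x| + b * |V N x|) : HasBddExpMoments μ W := by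
  intro s
  obtain ⟨K, hK⟩ := hU (2 * (|s| * a))
  obtain ⟨L, hL⟩ := hV (2 * (|s| * b))
  have exp_le (N : ℕ) (x : α N) : rexp (s * |W N x|) ≤
      (rexp (2 * (|s| * a) * |U N x|) + rexp (2 * (|s| * b) * |V N x|)) / 2 := by
    have linear : s * |W N x| ≤ |s| * a * |U N x| + |s| * b * |V N x| := by
      calc s * |W N x| ≤ |s| * (a * |U N x| + b * |V N x|) := by
            gcongr
            exacts [le_abs_self s, hle N x]
        _ = _ := by ring
    simpa only [mul_assoc] using
      (Real.exp_le_exp.2 linear).trans (exp_add_le_half_add _ _)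
  have hint (N : ℕ) : Integrable (fun x => (rexp (2 * (|s| * a) * |U N x|) +
      rexp (2 * (|s| * b) * |V N x|)) / 2) (μ N) := ((hK N).1.add (hL N).1).div_const 2
  have hWint (N : ℕ) : Integrable (fun x => rexp (s * |W N x|)) (μ N) :=
    (hint N).mono' (by have := hW N; fun_prop)
      (ae_of_all _ fun x => by simpa only [Real.norm_eq_abs, Real.abs_exp] using exp_le N x)
  refine ⟨(K + L) / 2, fun N => ⟨hWint N, ?_⟩⟩
  refine (integral_mono (hWint N) (hint N) (exp_le N)).trans ?_
  rw [integral_div, integral_add (hK N).1 (hL N).1]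
  linarith [(hK N).2, (hL N).2]

lemma map {β : ℕ → Type*} [∀ N, MeasurableSpace (β N)] {φ : ∀ N, β N → α N}
    {ν : ∀ N, Measure (β N)} (hW : HasBddExpMoments ν fun N x => W N (φ N x))
    (hφ : ∀ N, Measurable (φ N)) (hWm : ∀ N, Measurable (W N)) :
    HasBddExpMoments (fun N => (ν N).map (φ N)) W := by
  intro s
  have hmeas (N : ℕ) :
      AEStronglyMeasurable (fun x => rexp (s * |W N x|)) ((ν N).map (φ N)) := by
    have := hWm N
    fun_prop
  refine (hW s).imp fun K hK N => ?_
  rw [integrable_map_measure (hmeas N) (hφ N).aemeasurable,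
    integral_map (hφ N).aemeasurable (hmeas N)]
  exact hK N

lemma exists_integral_abs_rpow_le (hW : HasBddExpMoments μ W)
    (hWm : ∀ N, AEMeasurable (W N) (μ N)) {q : ℝ} (hq : 0 ≤ q) :
    ∃ K, ∀ N, Integrable (fun x => |W N x| ^ q) (μ N) ∧ ∫ x, |W N x| ^ q ∂μ N ≤ K := by
  obtain ⟨K, hK⟩ := hW 1
  have rpow_le (N : ℕ) (x : α N) : |W N x| ^ q ≤ q ^ q * rexp (1 * |W N x|) := by
    simpa using rpow_abs_le_mul_exp_abs (W N x) hq one_ne_zero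
  have hint (N : ℕ) : Integrable (fun x => |W N x| ^ q) (μ N) :=
    ((hK N).1.const_mul (q ^ q)).mono' (by have := hWm N; fun_prop)
      (ae_of_all _ fun x => by
        simpa only [Real.norm_eq_abs, abs_of_nonneg (Real.rpow_nonneg (abs_nonneg _) q)]
          using rpow_le N x)
  refine ⟨q ^ q * K, fun N => ⟨hint N, ?_⟩⟩
  refine (integral_mono (hint N) ((hK N).1.const_mul _) (rpow_le N)).trans ?_
  rw [integral_const_mul]
  exact mul_le_mul_of_nonneg_left (hK N).2 (Real.rpow_nonneg hq q)

lemma tendsto_integral_abs_div_sqrt (hW : HasBddExpMoments μ W)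
    (hWm : ∀ N, AEMeasurable (W N) (μ N)) :
    Tendsto (fun N => ∫ x, |W N x / √(N + 1 : ℕ)| ∂μ N) atTop (𝓝 0) := by
  obtain ⟨K, hK⟩ := hW.exists_integral_abs_rpow_le hWm zero_le_one
  have hlim : Tendsto (fun N : ℕ => K / √(N + 1 : ℕ)) atTop (𝓝 0) :=
    tendsto_div_sqrt_add_one _
  refine squeeze_zero (fun N => integral_nonneg fun x => abs_nonneg _) (fun N => ?_) hlim
  simp_rw [abs_div, abs_of_nonneg (Real.sqrt_nonneg _)]
  rw [integral_div]
  gcongr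
  simpa only [Real.rpow_one] using (hK N).2

lemma tendsto_integral_abs_mul_div_sqrt (hU : HasBddExpMoments μ U) (hV : HasBddExpMoments μ V)
    (hUm : ∀ N, AEMeasurable (U N) (μ N)) (hVm : ∀ N, AEMeasurable (V N) (μ N)) :
    Tendsto (fun N => ∫ x, |U N x * V N x / √(N + 1 : ℕ)| ∂μ N) atTop (𝓝 0) := by
  obtain ⟨K, hK⟩ := hU.exists_integral_abs_rpow_le hUm zero_le_two
  obtain ⟨L, hL⟩ := hV.exists_integral_abs_rpow_le hVm zero_le_two
  simp only [Real.rpow_two] at hK hL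
  have hlim : Tendsto (fun N : ℕ => (K + L) / √(N + 1 : ℕ)) atTop (𝓝 0) :=
    tendsto_div_sqrt_add_one _
  refine squeeze_zero (fun N => integral_nonneg fun x => abs_nonneg _) (fun N => ?_) hlim
  simp_rw [abs_div, abs_of_nonneg (Real.sqrt_nonneg _)]
  rw [integral_div]
  gcongr
  calc ∫ x, |U N x * V N x| ∂μ N ≤ ∫ x, (|U N x| ^ 2 + |V N x| ^ 2) ∂μ N := by
        refine integral_mono_of_nonneg (ae_of_all _ fun x => abs_nonneg _)
          ((hK N).1.add (hL N).1) (ae_of_all _ fun x => ?_)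
        simp only [abs_mul]
        nlinarith [sq_nonneg (|U N x| - |V N x|), sq_nonneg (|U N x|), sq_nonneg (|V N x|)]
    _ ≤ K + L := by
      rw [integral_add (hK N).1 (hL N).1]
      exact add_le_add (hK N).2 (hL N).2

end HasBddExpMoments

namespace IsAsympNormal

lemma map {β : ℕ → Type*} [∀ N, MeasurableSpace (β N)] {φ : ∀ N, β N → α N}
    {ν : ∀ N, Measure (β N)} {v : ℝ} (hW : IsAsympNormal ν (fun N x => W N (φ N x)) v)
    (hφ : ∀ N, Measurable (φ N)) (hWm : ∀ N, Measurable (W N)) :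
    IsAsympNormal (fun N => (ν N).map (φ N)) W v := by
  refine fun t => (hW t).congr fun N => (integral_map (hφ N).aemeasurable ?_).symm
  have := hWm N
  fun_prop

lemma const_mul {v : ℝ} (hW : IsAsympNormal μ W v) (c : ℝ) :
    IsAsympNormal μ (fun N x => c * W N x) (c ^ 2 * v) := by
  intro t
  convert hW (t * c) using 3
  · simp only [mul_assoc]
  · ring_nf

lemma of_tendsto_integral_abs_sub [∀ N, IsFiniteMeasure (μ N)] {v : ℝ} (hW : IsAsympNormal μ W v)
    (hWm : ∀ N, AEMeasurable (W N) (μ N)) (hWm' : ∀ N, AEMeasurable (W' N) (μ N))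
    (hint : ∀ N, Integrable (fun x => W' N x - W N x) (μ N))
    (hsub : Tendsto (fun N => ∫ x, |W' N x - W N x| ∂μ N) atTop (𝓝 0)) :
    IsAsympNormal μ W' v := by
  intro t
  refine (tendsto_iff_of_dist ?_).1 (hW t)
  have hlim := hsub.const_mul |t|
  rw [mul_zero] at hlim
  refine squeeze_zero (fun _ => dist_nonneg) (fun N => ?_) hlim
  rw [dist_comm, dist_eq_norm,
    ← integral_sub (integrable_cexp_mul_I (by have := hWm' N; fun_prop))
    (integrable_cexp_mul_I (by have := hWm N; fun_prop)), ← integral_const_mul]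
  refine norm_integral_le_of_norm_le ((hint N).abs.const_mul _) (ae_of_all _ fun x => ?_)
  refine (norm_cexp_mul_I_sub_le _ _).trans_eq ?_
  rw [← mul_sub, abs_mul]

end IsAsympNormal

end AsymptoticNotions

section ConditionalSampling

open scoped Real Complex

/-- Independent draws, indexed by `ι`, from a transition kernel. -/
noncomputable def iidKernel {α X : Type*} [MeasurableSpace α] [MeasurableSpace X]
    (κ : Kernel α X) [IsFiniteKernel κ] (ι : Type*) [Fintype ι] : Kernel α (ι → X) where
  toFun a := Measure.pi fun _ => κ a
  measurable' := by
    refine Measurable.measure_of_isPiSystem generateFrom_pi.symm isPiSystem_pi ?_ ?_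
    · rintro _ ⟨A, hA, rfl⟩
      simp_rw [Measure.pi_pi]
      exact Finset.measurable_fun_prod _ fun i _ => κ.measurable_coe (hA i (Set.mem_univ i))
    · simp_rw [Measure.pi_univ]
      exact Finset.measurable_fun_prod _ fun i _ => κ.measurable_coe .univ

lemma iidKernel_apply {α X : Type*} [MeasurableSpace α] [MeasurableSpace X] (κ : Kernel α X)
    [IsFiniteKernel κ] (ι : Type*) [Fintype ι] (a : α) :
    iidKernel κ ι a = Measure.pi fun _ => κ a := rfl

instance {α X : Type*} [MeasurableSpace α] [MeasurableSpace X] (κ : Kernel α X)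
    [IsFiniteKernel κ] (ι : Type*) [Fintype ι] : IsFiniteKernel (iidKernel κ ι) := by
  refine ⟨κ.bound ^ Fintype.card ι, ENNReal.pow_lt_top κ.bound_lt_top, fun a => ?_⟩
  rw [iidKernel_apply, Measure.pi_univ, Finset.prod_const, Finset.card_univ]
  gcongr
  exact κ.measure_le_bound a Set.univ

instance {α X : Type*} [MeasurableSpace α] [MeasurableSpace X] (κ : Kernel α X)
    [IsMarkovKernel κ] (ι : Type*) [Fintype ι] : IsMarkovKernel (iidKernel κ ι) :=
  ⟨fun a => inferInstanceAs (IsProbabilityMeasure (Measure.pi fun _ => κ a))⟩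

variable {α : ℕ → Type*} [∀ N, MeasurableSpace (α N)] {μ : ∀ N, Measure (α N)}
  [∀ N, IsProbabilityMeasure (μ N)] {X : Type*} [MeasurableSpace X] {W : ∀ N, α N → ℝ}
  {κ : ∀ N, Kernel (α N) X} [∀ N, IsMarkovKernel (κ N)] {f : X → ℝ}

lemma HasBddExpMoments.comp_fst {β : ℕ → Type*} [∀ N, MeasurableSpace (β N)]
    {η : ∀ N, Kernel (α N) (β N)} [∀ N, IsMarkovKernel (η N)] (hW : HasBddExpMoments μ W) :
    HasBddExpMoments (fun N => μ N ⊗ₘ η N) fun N q => W N q.1 := by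
  intro s
  obtain ⟨K, hK⟩ := hW s
  have hint (N : ℕ) : Integrable (fun q : α N × β N => rexp (s * |W N q.1|)) (μ N ⊗ₘ η N) := by
    have h := (hK N).1
    rw [← Measure.fst_compProd (μ N) (η N)] at h
    exact h.comp_measurable measurable_fst
  refine ⟨K, fun N => ⟨hint N, ?_⟩⟩
  rw [Measure.integral_compProd (hint N)]
  simpa using (hK N).2

/-- The sampling error with respect to the conditional law of the sample, given the past. -/
noncomputable def condEmpErr {α X : Type*} [MeasurableSpace α] [MeasurableSpace X]
    (κ : Kernel α X) {N : ℕ} (f : X → ℝ) (q : α × (Fin N → X)) : ℝ :=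
  empErr (κ q.1) f q.2

lemma BddMeasurable.condEmpErr {α : Type*} [MeasurableSpace α] (hf : BddMeasurable f)
    (κ : Kernel α X) [IsMarkovKernel κ] (N : ℕ) [NeZero N] :
    BddMeasurable (condEmpErr κ (N := N) f) :=
  (((hf.kernel_integral (empiricalKernel X N)).comp measurable_snd).sub
    ((hf.kernel_integral κ).comp measurable_fst)).const_mul _

lemma BddMeasurable.variance_kernel {α : Type*} [MeasurableSpace α] (hf : BddMeasurable f)
    (κ : Kernel α X) [IsMarkovKernel κ] : BddMeasurable fun a => Var[f; κ a] := by
  simp_rw [hf.variance_eq]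
  exact ((hf.pow 2).kernel_integral κ).sub ((hf.kernel_integral κ).pow 2)

lemma HasBddExpMoments.condEmpErr (μ : ∀ N, Measure (α N)) [∀ N, IsProbabilityMeasure (μ N)]
    (κ : ∀ N, Kernel (α N) X) [∀ N, IsMarkovKernel (κ N)] (hf : BddMeasurable f) :
    HasBddExpMoments (fun N => μ N ⊗ₘ iidKernel (κ N) (Fin (N + 1)))
      fun N => condEmpErr (κ N) f := by
  intro s
  obtain ⟨C, hC⟩ := hf.bounded
  have hint (N : ℕ) := ((hf.condEmpErr (κ N) (N + 1)).abs.const_mul s).exp.integrable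
    (μ N ⊗ₘ iidKernel (κ N) (Fin (N + 1)))
  refine ⟨2 * rexp (C ^ 2 * s ^ 2 / 2), fun N => ⟨hint N, ?_⟩⟩
  rw [Measure.integral_compProd (hint N)]
  refine (le_abs_self _).trans (abs_integral_le_of_forall_abs_le (fun a => ?_) (μ N))
  rw [abs_of_nonneg (integral_nonneg fun _ => (Real.exp_pos _).le)]
  exact integral_exp_mul_abs_empErr_le (κ N a) hf.measurable hC s

lemma norm_integral_cexp_empErr_sub_exp_le (hf : BddMeasurable f) (t : ℝ) :
    ∃ B, ∀ (N : ℕ) [NeZero N] (ν : Measure X) [IsProbabilityMeasure ν] (w : ℝ), 0 ≤ w →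
      ‖∫ x : Fin N → X, cexp ((t * empErr ν f x : ℝ) * Complex.I) ∂(Measure.pi fun _ => ν) -
        (rexp (-(t ^ 2 * w / 2)) : ℝ)‖ ≤ B / √N + t ^ 2 / 2 * |Var[f; ν] - w| := by
  obtain ⟨C, hC⟩ := hf.bounded
  refine ⟨_, fun N _ ν _ w hw => (norm_sub_le_norm_sub_add_norm_sub _ _ _).trans <|
    add_le_add (norm_integral_cexp_empErr_sub_le ν hf.measurable hC t) ?_⟩
  rw [← Complex.ofReal_sub, Complex.norm_real, Real.norm_eq_abs]
  have hvar := variance_nonneg f ν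
  refine (abs_exp_neg_sub_exp_neg_le (by positivity) (by positivity)).trans_eq ?_
  rw [← sub_div, ← mul_sub, abs_div, abs_mul, abs_sq, abs_two]
  ring

lemma norm_integral_cexp_add_sub_mul_le {α β : Type*} [MeasurableSpace α] [MeasurableSpace β]
    {μ : Measure α} [IsProbabilityMeasure μ] {η : Kernel α β} [IsMarkovKernel η] {U b : α → ℝ}
    {V : α × β → ℝ} (hU : Measurable U) (hV : Measurable V) (hb : Integrable b μ) {c : ℂ}
    (hle : ∀ a, ‖∫ x, cexp (V (a, x) * Complex.I) ∂η a - c‖ ≤ b a) :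
    ‖∫ q, cexp ((U q.1 + V q : ℝ) * Complex.I) ∂(μ ⊗ₘ η) -
      (∫ a, cexp (U a * Complex.I) ∂μ) * c‖ ≤ ∫ a, b a ∂μ := by
  have hint : Integrable (fun q => cexp ((U q.1 + V q : ℝ) * Complex.I)) (μ ⊗ₘ η) :=
    integrable_cexp_mul_I (by fun_prop)
  have hintU : Integrable (fun a => cexp (U a * Complex.I) * c) μ :=
    (integrable_cexp_mul_I hU.aemeasurable).mul_const c
  have hintV : Integrable (fun a => ∫ x, cexp ((U a + V (a, x) : ℝ) * Complex.I) ∂η a) μ :=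
    hint.integral_compProd
  rw [Measure.integral_compProd hint, ← integral_mul_const, ← integral_sub hintV hintU]
  refine norm_integral_le_of_norm_le hb (ae_of_all _ fun a => ?_)
  have factor (x : β) : cexp ((U a + V (a, x) : ℝ) * Complex.I) =
      cexp (U a * Complex.I) * cexp (V (a, x) * Complex.I) := by
    rw [← Complex.exp_add, ← add_mul, ← Complex.ofReal_add]
  simp_rw [factor]
  rw [integral_const_mul, ← mul_sub, norm_mul, Complex.norm_exp_ofReal_mul_I, one_mul]
  exact hle a

/-- Given the past, the sampling error is nearly Gaussian with the conditional variance, uniformly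
in the past, so its characteristic function factors out in the limit. -/
lemma IsAsympNormal.add_condEmpErr {v w : ℝ} (hW : IsAsympNormal μ W v)
    (hWm : ∀ N, Measurable (W N)) (hf : BddMeasurable f) (hw : 0 ≤ w)
    (hvar : Tendsto (fun N => ∫ a, |Var[f; κ N a] - w| ∂μ N) atTop (𝓝 0)) :
    IsAsympNormal (fun N => μ N ⊗ₘ iidKernel (κ N) (Fin (N + 1)))
      (fun N q => W N q.1 + condEmpErr (κ N) f q) (v + w) := by
  intro t
  obtain ⟨B, hB⟩ := norm_integral_cexp_empErr_sub_exp_le hf t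
  have hmain : Tendsto (fun N => (∫ a, cexp ((t * W N a : ℝ) * Complex.I) ∂μ N) *
      (rexp (-(t ^ 2 * w / 2)) : ℝ)) atTop (𝓝 (rexp (-(t ^ 2 * (v + w) / 2)) : ℝ)) := by
    convert (hW t).mul_const _ using 2
    rw [← Complex.ofReal_mul, ← Real.exp_add]
    ring_nf
  have hlim : Tendsto (fun N : ℕ => B / √(N + 1 : ℕ) +
      t ^ 2 / 2 * ∫ a, |Var[f; κ N a] - w| ∂μ N) atTop (𝓝 0) := by
    simpa using (tendsto_div_sqrt_add_one B).add (hvar.const_mul (t ^ 2 / 2))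
  refine (tendsto_iff_of_dist ?_).1 hmain
  refine squeeze_zero (fun _ => dist_nonneg) (fun N => ?_) hlim
  have hbound : Integrable (fun a => t ^ 2 / 2 * |Var[f; κ N a] - w|) (μ N) :=
    ((((hf.variance_kernel (κ N)).sub (.const w)).abs).const_mul _).integrable _
  have close := norm_integral_cexp_add_sub_mul_le (μ := μ N)
    (η := iidKernel (κ N) (Fin (N + 1))) ((hWm N).const_mul t)
    ((hf.condEmpErr (κ N) (N + 1)).measurable.const_mul t)
    ((integrable_const (B / √(N + 1 : ℕ))).add hbound) fun a => hB (N + 1) (κ N a) w hw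
  simp only [← mul_add] at close
  rw [dist_comm, dist_eq_norm]
  refine close.trans_eq ?_
  simp only [Pi.add_apply]
  rw [integral_add (integrable_const _) hbound, integral_const_mul]
  simp

end ConditionalSampling

section MomentConvergence

open scoped Real Complex

lemma abs_integral_sub_integral_min_le {E : Type*} [MeasurableSpace E] {ρ : Measure E}
    [IsFiniteMeasure ρ] {f : E → ℝ} {R : ℝ} (hR : 0 < R) (hf : AEStronglyMeasurable f ρ)
    (hf0 : ∀ x, 0 ≤ f x) (hsq : Integrable (fun x => f x ^ 2) ρ) :
    |∫ x, f x ∂ρ - ∫ x, min (f x) R ∂ρ| ≤ (∫ x, f x ^ 2 ∂ρ) / R := by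
  have hint : Integrable f ρ := ((memLp_two_iff_integrable_sq hf).2 hsq).integrable one_le_two
  have hmin : Integrable (fun x => min (f x) R) ρ := hint.inf (integrable_const R)
  rw [← integral_sub hint hmin, ← integral_div, ← Real.norm_eq_abs]
  refine norm_integral_le_of_norm_le (hsq.div_const R) (ae_of_all _ fun x => ?_)
  have hfx := hf0 x
  rw [Real.norm_eq_abs, le_div_iff₀ hR, abs_of_nonneg (sub_nonneg.2 (min_le_left _ _))]
  rcases le_total (f x) R with h | h
  · simp only [min_eq_left h, sub_self, zero_mul]
    positivity
  · rw [min_eq_right h]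
    nlinarith

lemma tendsto_integral_of_integral_sq_le {E ι : Type*} [TopologicalSpace E] [MeasurableSpace E]
    [OpensMeasurableSpace E] {l : Filter ι} {ρ : ι → ProbabilityMeasure E}
    {ρ₀ : ProbabilityMeasure E} (hρ : Tendsto ρ l (𝓝 ρ₀)) {f : E → ℝ} (hf : Continuous f)
    (hf0 : ∀ x, 0 ≤ f x) {K : ℝ}
    (hsq : ∀ i, Integrable (fun x => f x ^ 2) (ρ i : Measure E) ∧
      ∫ x, f x ^ 2 ∂(ρ i : Measure E) ≤ K)
    (hsq₀ : Integrable (fun x => f x ^ 2) (ρ₀ : Measure E)) :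
    Tendsto (fun i => ∫ x, f x ∂(ρ i : Measure E)) l (𝓝 (∫ x, f x ∂(ρ₀ : Measure E))) := by
  have tendsto_min (R : ℝ) (hR : 0 < R) :
      Tendsto (fun i => ∫ x, min (f x) R ∂(ρ i : Measure E)) l
        (𝓝 (∫ x, min (f x) R ∂(ρ₀ : Measure E))) :=
    ProbabilityMeasure.tendsto_iff_forall_integral_tendsto.1 hρ
      (.ofNormedAddCommGroup _ (hf.min continuous_const) R fun x => by
        rw [Real.norm_eq_abs, abs_of_nonneg (le_min (hf0 x) hR.le)]
        exact min_le_right _ _)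
  set L := max K (∫ x, f x ^ 2 ∂(ρ₀ : Measure E))
  have : 0 ≤ L := (integral_nonneg fun x => sq_nonneg (f x)).trans (le_max_right _ _)
  refine Metric.tendsto_nhds.2 fun ε hε => ?_
  set R := 3 * (L + 1) / ε with hRdef
  have hR : 0 < R := by positivity
  have hsmall : L / R < ε / 3 := by
    rw [div_lt_iff₀ hR, hRdef]
    field_simp
    linarith
  have trunc {ν : ProbabilityMeasure E} (hν : Integrable (fun x => f x ^ 2) (ν : Measure E))
      (hνL : ∫ x, f x ^ 2 ∂(ν : Measure E) ≤ L) :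
      |∫ x, f x ∂(ν : Measure E) - ∫ x, min (f x) R ∂(ν : Measure E)| < ε / 3 := by
    refine (abs_integral_sub_integral_min_le hR hf.measurable.aestronglyMeasurable hf0 hν).trans_lt
      (lt_of_le_of_lt ?_ hsmall)
    gcongr
  filter_upwards [Metric.tendsto_nhds.1 (tendsto_min R hR) (ε / 3) (by positivity)] with i hi
  have hρi := abs_lt.1 (trunc (hsq i).1 ((hsq i).2.trans (le_max_left _ _)))
  have hρ₀ := abs_lt.1 (trunc hsq₀ (le_max_right _ _))
  rw [Real.dist_eq, abs_lt] at hi ⊢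
  constructor <;> linarith

lemma gaussianPDFReal_smul_abs_rpow (v : NNReal) (p x : ℝ) :
    gaussianPDFReal 0 v x • |x| ^ p =
      (√(2 * π * v))⁻¹ * (|x| ^ p * rexp (-(1 / (2 * v)) * |x| ^ (2 : ℝ))) := by
  rw [gaussianPDFReal, smul_eq_mul, sub_zero, Real.rpow_two, sq_abs,
    show -x ^ 2 / (2 * v) = -(1 / (2 * v)) * x ^ 2 by ring]
  ring

lemma integral_abs_rpow_gaussianReal (v : NNReal) {p : ℝ} (hp : 0 < p) :
    ∫ x, |x| ^ p ∂gaussianReal 0 v =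
      (2 * v) ^ (p / 2) * (Real.Gamma ((p + 1) / 2) / √π) := by
  rcases eq_or_ne v 0 with rfl | hv
  · simp [gaussianReal_zero_var, Real.zero_rpow hp.ne', Real.zero_rpow (half_pos hp).ne']
  have : (0 : ℝ) < v := NNReal.coe_pos.2 (pos_iff_ne_zero.2 hv)
  have hrpow : (1 / (2 * (v : ℝ))) ^ (-(p + 1) / 2) = (2 * v) ^ (p / 2) * √(2 * v) := by
    rw [one_div, Real.inv_rpow (by positivity), ← Real.rpow_neg (by positivity),
      Real.sqrt_eq_rpow, ← Real.rpow_add (by positivity)]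
    ring_nf
  have hsqrt : √(2 * π * v) = √(2 * v) * √π := by
    rw [← Real.sqrt_mul (by positivity)]
    ring_nf
  rw [integral_gaussianReal_eq_integral_smul hv]
  simp_rw [gaussianPDFReal_smul_abs_rpow]
  rw [integral_comp_abs (f := fun r : ℝ => (√(2 * π * v))⁻¹ *
      (r ^ p * rexp (-(1 / (2 * v)) * r ^ (2 : ℝ)))), integral_const_mul,
    integral_rpow_mul_exp_neg_mul_rpow two_pos (by linarith) (by positivity), hrpow, hsqrt]
  have : √(2 * (v : ℝ)) ≠ 0 := by positivity
  field_simp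

lemma integrable_abs_rpow_gaussianReal (v : NNReal) {p : ℝ} (hp : 0 ≤ p) :
    Integrable (fun x => |x| ^ p) (gaussianReal 0 v) := by
  refine integrable_rpow_abs_of_integrable_exp_mul (X := fun x => x) one_ne_zero ?_ ?_ hp
  · exact integrable_exp_mul_gaussianReal 1
  · exact integrable_exp_mul_gaussianReal (-1)

lemma abs_rpow_sq (x p : ℝ) : (|x| ^ p) ^ 2 = |x| ^ (p * 2) := by
  rw [← Real.rpow_two, ← Real.rpow_mul (abs_nonneg x)]

variable {α : ℕ → Type*} [∀ N, MeasurableSpace (α N)] {μ : ∀ N, Measure (α N)}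
  [∀ N, IsProbabilityMeasure (μ N)] {W : ∀ N, α N → ℝ}

lemma IsAsympNormal.tendsto_map {v : NNReal} (hW : IsAsympNormal μ W v)
    (hWm : ∀ N, AEMeasurable (W N) (μ N)) :
    Tendsto (β := ProbabilityMeasure ℝ)
      (fun N => ⟨(μ N).map (W N), Measure.isProbabilityMeasure_map (hWm N)⟩) atTop
      (𝓝 ⟨gaussianReal 0 v, inferInstance⟩) := by
  refine ProbabilityMeasure.tendsto_of_tendsto_charFun fun t => ?_
  simp only [ProbabilityMeasure.coe_mk]
  rw [charFun_gaussianReal]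
  convert hW t using 2 with N
  · rw [charFun_apply_real, integral_map (hWm N) (by fun_prop)]
    push_cast
    rfl
  · push_cast
    ring_nf

lemma IsAsympNormal.tendsto_integral_abs_rpow {v p : ℝ} (hW : IsAsympNormal μ W v)
    (hexp : HasBddExpMoments μ W) (hWm : ∀ N, AEMeasurable (W N) (μ N)) (hv : 0 ≤ v) (hp : 0 < p) :
    Tendsto (fun N => ∫ x, |W N x| ^ p ∂μ N) atTop
      (𝓝 ((2 * v) ^ (p / 2) * (Real.Gamma ((p + 1) / 2) / √π))) := by
  lift v to NNReal using hv
  obtain ⟨K, hK⟩ := hexp.exists_integral_abs_rpow_le hWm (q := p * 2) (by positivity)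
  have hcont : Continuous fun x : ℝ => |x| ^ p :=
    continuous_abs.rpow_const fun _ => Or.inr hp.le
  have hmeas (N : ℕ) :
      AEStronglyMeasurable (fun x : ℝ => |x| ^ (p * 2)) ((μ N).map (W N)) :=
    (by fun_prop : Measurable fun x : ℝ => |x| ^ (p * 2)).aestronglyMeasurable
  rw [← integral_abs_rpow_gaussianReal v hp]
  refine (tendsto_integral_of_integral_sq_le (hW.tendsto_map hWm) hcont
    (fun x => by positivity) (K := K) (fun N => ?_) ?_).congr fun N => ?_
  · simp only [abs_rpow_sq, ProbabilityMeasure.coe_mk]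
    rw [integrable_map_measure (hmeas N) (hWm N), integral_map (hWm N) (hmeas N)]
    exact hK N
  · simp only [abs_rpow_sq]
    exact integrable_abs_rpow_gaussianReal v (by positivity)
  · exact integral_map (hWm N) hcont.aestronglyMeasurable

end MomentConvergence

lemma integral_bind_kernel {α β E : Type*} [MeasurableSpace α] [MeasurableSpace β]
    [NormedAddCommGroup E] [NormedSpace ℝ E] {μ : Measure α} {κ : Kernel α β} {f : β → E}
    (hf : Integrable f (μ.bind κ)) : ∫ z, f z ∂(μ.bind κ) = ∫ x, ∫ z, f z ∂(κ x) ∂μ := by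
  have comp_const : (κ ∘ₖ Kernel.const Unit μ) () = μ.bind κ := by
    rw [Kernel.comp_apply, Kernel.const_apply]
  rw [← comp_const] at hf ⊢
  rw [Kernel.integral_comp hf, Kernel.const_apply]

namespace HiddenMarkovModel

variable {X Y : Type*} [MeasurableSpace X] [MeasurableSpace Y] (M : HiddenMarkovModel X Y)

section Update

lemma measurable_g_left (y : Y) : Measurable fun x => M.g x y :=
  M.measurable_g.comp (measurable_id.prodMk measurable_const)

lemma integral_update (y : Y) (μ : Measure X) (f : X → ℝ) :
    ∫ x, f x ∂M.update y μ = (∫ x, M.g x y * f x ∂μ) / ∫ x, M.g x y ∂μ := by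
  have mass_eq : (∫⁻ x, ENNReal.ofReal (M.g x y) ∂μ).toReal = ∫ x, M.g x y ∂μ :=
    (integral_eq_lintegral_of_nonneg_ae (ae_of_all _ fun x => M.g_nonneg x y)
      (M.measurable_g_left y).aestronglyMeasurable).symm
  rw [update, integral_smul_measure, ENNReal.toReal_inv, mass_eq,
    integral_withDensity_eq_integral_toReal_smul (M.measurable_g_left y).ennreal_ofReal
      (ae_of_all _ fun x => ENNReal.ofReal_lt_top)]
  simp only [ENNReal.toReal_ofReal (M.g_nonneg _ _), smul_eq_mul]
  rw [div_eq_inv_mul]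

lemma update_smul (y : Y) {c : ℝ≥0∞} (hc : c ≠ 0) (hc' : c ≠ ∞) (μ : Measure X) :
    M.update y (c • μ) = M.update y μ := by
  rw [update, lintegral_smul_measure, withDensity_smul_measure, smul_smul, update, smul_eq_mul,
    ENNReal.mul_inv (.inl hc) (.inl hc'), mul_right_comm, ENNReal.inv_mul_cancel hc hc', one_mul]

lemma stepKernel_apply (y : Y) (x : X) :
    M.stepKernel y x = ENNReal.ofReal (M.g x y) • M.Q x := by
  have hg : Measurable (Function.uncurry fun (x _ : X) => ENNReal.ofReal (M.g x y)) :=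
    (M.measurable_g_left y).ennreal_ofReal.comp measurable_fst
  rw [stepKernel, Kernel.withDensity_apply _ hg, withDensity_const]

lemma bind_stepKernel (y : Y) (μ : Measure X) :
    μ.bind (M.stepKernel y) = (μ.withDensity fun x => ENNReal.ofReal (M.g x y)).bind M.Q := by
  ext A hA
  rw [Measure.bind_apply hA (Kernel.aemeasurable _), Measure.bind_apply hA (Kernel.aemeasurable _),
    lintegral_withDensity_eq_lintegral_mul _ (M.measurable_g_left y).ennreal_ofReal
      (M.Q.measurable_coe hA)]
  simp only [stepKernel_apply, Measure.smul_apply, smul_eq_mul, Pi.mul_apply]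

lemma bind_stepKernel_univ (y : Y) (μ : Measure X) :
    μ.bind (M.stepKernel y) Set.univ = ∫⁻ x, ENNReal.ofReal (M.g x y) ∂μ := by
  rw [Measure.bind_apply .univ (Kernel.aemeasurable _)]
  simp [stepKernel_apply]

lemma feynmanKac_eq_smul_bind (y : Y) (μ : Measure X) :
    M.feynmanKac y μ = (μ.bind (M.stepKernel y) Set.univ)⁻¹ • μ.bind (M.stepKernel y) := by
  rw [feynmanKac, update, Measure.bind_smul, bind_stepKernel_univ, bind_stepKernel]

end Update

/-- An observation whose likelihood function `g(·, y)` is positive and bounded, so that updating by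
`y` never divides by `0` or `∞`. -/
class RegularObs (y : Y) : Prop where
  pos : ∀ x, 0 < M.g x y
  bdd : ∃ C, ∀ x, M.g x y ≤ C

section RegularObs

variable (y : Y) [M.RegularObs y] (μ : Measure X) {f : X → ℝ}

lemma bddMeasurable_g : BddMeasurable fun x => M.g x y :=
  ⟨M.measurable_g_left y, (RegularObs.bdd (M := M) (y := y)).imp fun C hC x => by
    simpa only [abs_of_nonneg (M.g_nonneg x y)] using hC x⟩

variable [IsFiniteMeasure μ] [NeZero μ]

lemma integral_g_pos : 0 < ∫ x, M.g x y ∂μ :=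
  (M.bddMeasurable_g y).integral_pos RegularObs.pos μ

lemma lintegral_g_ne_zero : ∫⁻ x, ENNReal.ofReal (M.g x y) ∂μ ≠ 0 := by
  rw [← ofReal_integral_eq_lintegral_ofReal ((M.bddMeasurable_g y).integrable μ)
    (ae_of_all _ fun x => M.g_nonneg x y)]
  exact (ENNReal.ofReal_pos.2 (M.integral_g_pos y μ)).ne'

instance : IsProbabilityMeasure (M.update y μ) := by
  refine ⟨?_⟩
  rw [update, Measure.smul_apply, withDensity_apply _ .univ, Measure.restrict_univ, smul_eq_mul,
    ENNReal.inv_mul_cancel (M.lintegral_g_ne_zero y μ)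
      ((M.bddMeasurable_g y).integrable μ).lintegral_lt_top.ne]

instance : IsProbabilityMeasure (M.feynmanKac y μ) :=
  inferInstanceAs (IsProbabilityMeasure ((M.update y μ).bind M.Q))

instance : IsFiniteKernel (M.stepKernel y) :=
  let ⟨_, hC⟩ := RegularObs.bdd (M := M) (y := y)
  Kernel.isFiniteKernel_withDensity_of_bounded M.Q ENNReal.ofReal_ne_top
    fun x _ => ENNReal.ofReal_le_ofReal (hC x)

instance : NeZero (μ.bind (M.stepKernel y)) := by
  refine ⟨fun h => M.lintegral_g_ne_zero y μ ?_⟩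
  rw [← bind_stepKernel_univ, h, Measure.coe_zero, Pi.zero_apply]

lemma integral_feynmanKac (hf : BddMeasurable f) :
    ∫ x, f x ∂M.feynmanKac y μ = ∫ x, ∫ x', f x' ∂M.Q x ∂M.update y μ :=
  integral_bind_kernel (hf.integrable (M.feynmanKac y μ))

lemma integral_g_mul_sub_update (hf : BddMeasurable f) :
    ∫ x, M.g x y * (f x - ∫ x', f x' ∂M.update y μ) ∂μ = 0 := by
  have hg := M.bddMeasurable_g y
  simp_rw [mul_sub]
  rw [integral_sub ((hg.mul hf).integrable _) ((hg.integrable _).mul_const _), integral_mul_const,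
    integral_update, mul_div_cancel₀ _ (M.integral_g_pos y μ).ne', sub_self]

end RegularObs

section Predictor

lemma lkh_self (y : ℕ → Y) (k : ℕ) : M.lkh y k k = Kernel.id := by
  cases k <;> simp [lkh]

lemma lkh_succ (y : ℕ → Y) {k n : ℕ} (h : k ≤ n) :
    M.lkh y k (n + 1) = M.stepKernel (y n) ∘ₖ M.lkh y k n := by
  simp [lkh, h]

lemma lkhFun_self (y : ℕ → Y) (k : ℕ) {f : X → ℝ} (hf : Measurable f) :
    M.lkhFun y k k f = f := by
  ext x
  rw [lkhFun, lkh_self, Kernel.id_apply, integral_dirac' _ _ hf.stronglyMeasurable]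

lemma bind_lkh_succ (χ : Measure X) (y : ℕ → Y) (n : ℕ) :
    χ.bind (M.lkh y 0 (n + 1)) = (χ.bind (M.lkh y 0 n)).bind (M.stepKernel (y n)) := by
  rw [M.lkh_succ y n.zero_le, Measure.comp_assoc]

variable (χ : Measure X) [IsProbabilityMeasure χ] (y : ℕ → Y)

lemma pred_zero : M.pred χ y 0 = χ := by
  simp [pred, lkh]

variable [∀ k, M.RegularObs (y k)]

instance (k n : ℕ) : IsFiniteKernel (M.lkh y k n) := by
  induction n with
  | zero => exact inferInstanceAs (IsFiniteKernel Kernel.id)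
  | succ n ih =>
    rw [lkh]
    split_ifs <;> infer_instance

instance (n : ℕ) : NeZero (χ.bind (M.lkh y 0 n)) := by
  induction n with
  | zero =>
    rw [lkh_self, Measure.id_comp]
    infer_instance
  | succ n ih =>
    rw [bind_lkh_succ]
    infer_instance

lemma pred_succ (n : ℕ) : M.pred χ y (n + 1) = M.feynmanKac (y n) (M.pred χ y n) := by
  rw [pred, bind_lkh_succ, ← feynmanKac_eq_smul_bind, pred, feynmanKac, feynmanKac, update_smul]
  · exact ENNReal.inv_ne_zero.2 (measure_ne_top _ _)
  · exact ENNReal.inv_ne_top.2 (Measure.measure_univ_ne_zero.2 (NeZero.ne _))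

instance (n : ℕ) : IsProbabilityMeasure (M.pred χ y n) := by
  induction n with
  | zero => rwa [pred_zero]
  | succ n ih =>
    rw [pred_succ]
    infer_instance

variable {f : X → ℝ}

lemma integral_pred_succ (n : ℕ) (hf : BddMeasurable f) :
    ∫ x, f x ∂M.pred χ y (n + 1) = ∫ x, ∫ x', f x' ∂M.Q x ∂M.filt χ y n := by
  rw [pred_succ, integral_feynmanKac _ _ _ hf, filt]

lemma lkhFun_succ {k n : ℕ} (h : k ≤ n) (hf : BddMeasurable f) :
    M.lkhFun y k (n + 1) f = M.lkhFun y k n fun x => M.g x (y n) * ∫ x', f x' ∂M.Q x := by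
  ext x
  rw [lkhFun, M.lkh_succ y h, Kernel.integral_comp (hf.integrable _), lkhFun]
  simp only [stepKernel_apply, integral_smul_measure, ENNReal.toReal_ofReal (M.g_nonneg _ _),
    smul_eq_mul]

lemma lkhFun_succ_one {k n : ℕ} (h : k ≤ n) :
    M.lkhFun y k (n + 1) (fun _ => 1) = M.lkhFun y k n fun x => M.g x (y n) := by
  simp [M.lkhFun_succ y h (.const 1)]

lemma lkhFun_sub_const_mul (k n : ℕ) (hf : BddMeasurable f) (c : ℝ) (x : X) :
    M.lkhFun y k n f x - c * M.lkhFun y k n (fun _ => 1) x =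
      M.lkhFun y k n (fun x => f x - c) x := by
  rw [lkhFun, lkhFun, lkhFun, integral_sub (hf.integrable _) (integrable_const _)]
  simp [mul_comm]

lemma integral_lkhFun_pred {k n : ℕ} (h : k ≤ n) (hf : BddMeasurable f) :
    ∫ x, M.lkhFun y k n f x ∂M.pred χ y k =
      (∫ x, M.lkhFun y k n (fun _ => 1) x ∂M.pred χ y k) * ∫ x, f x ∂M.pred χ y n := by
  induction n, h using Nat.le_induction generalizing f with
  | base => simp [lkhFun_self, hf.measurable]
  | succ n hn ih =>
    have hg := M.bddMeasurable_g (y n)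
    have hpos := M.integral_g_pos (y n) (M.pred χ y n)
    rw [M.lkhFun_succ y hn hf, M.lkhFun_succ_one y hn, ih (hg.mul (hf.kernel_integral M.Q)), ih hg,
      M.integral_pred_succ χ y n hf, filt, integral_update]
    field_simp

end Predictor

section AsymptoticVariance

variable (χ : Measure X) (y : ℕ → Y) (n : ℕ)

lemma predVariance_nonneg (f : X → ℝ) : 0 ≤ M.predVariance χ y n f :=
  Finset.sum_nonneg fun _ _ => integral_nonneg fun _ => sq_nonneg _

lemma filtVariance_nonneg (h : X → ℝ) : 0 ≤ M.filtVariance χ y n h :=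
  div_nonneg (M.predVariance_nonneg χ y n _) (sq_nonneg _)

variable [IsProbabilityMeasure χ] {f : X → ℝ}

lemma predVariance_zero (hf : Measurable f) : M.predVariance χ y 0 f = Var[f; χ] := by
  simp [predVariance, pred_zero, lkhFun_self, hf, variance_eq_integral hf.aemeasurable]

variable [∀ k, M.RegularObs (y k)]

lemma predVariance_succ (hf : BddMeasurable f) :
    M.predVariance χ y (n + 1) f =
      Var[f; M.pred χ y (n + 1)] + M.filtVariance χ y n fun x => ∫ x', f x' ∂M.Q x := by
  have hQ := hf.kernel_integral M.Q
  rw [predVariance, Finset.sum_range_succ, add_comm, filtVariance, predVariance, Finset.sum_div,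
    filt, M.integral_g_mul_sub_update (y n) _ hQ, ← filt, ← M.integral_pred_succ χ y n hf]
  congr 1
  · simp [lkhFun_self, hf.measurable, variance_eq_integral hf.measurable.aemeasurable]
  · refine Finset.sum_congr rfl fun k hk => ?_
    have hkn : k ≤ n := Nat.lt_succ_iff.1 (Finset.mem_range.1 hk)
    have Q_sub (c : ℝ) (x : X) : ∫ x', (f x' - c) ∂M.Q x = ∫ x', f x' ∂M.Q x - c := by
      rw [integral_sub (hf.integrable _) (integrable_const _)]
      simp
    rw [← integral_div]
    congr with x
    rw [M.lkhFun_sub_const_mul y k (n + 1) hf, M.lkhFun_succ y hkn (hf.sub (.const _)),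
      M.lkhFun_succ_one y hkn, M.integral_lkhFun_pred χ y hkn (M.bddMeasurable_g (y n))]
    simp only [Q_sub, zero_mul, sub_zero, div_pow, div_div, mul_pow]

end AsymptoticVariance

section Measurability

variable {α : Type*} [MeasurableSpace α]

lemma lintegral_update (y : Y) (μ : Measure X) {F : X → ℝ≥0∞} (hF : Measurable F) :
    ∫⁻ x, F x ∂M.update y μ =
      (∫⁻ x, ENNReal.ofReal (M.g x y) ∂μ)⁻¹ * ∫⁻ x, ENNReal.ofReal (M.g x y) * F x ∂μ := by
  rw [update, lintegral_smul_measure,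
    lintegral_withDensity_eq_lintegral_mul _ (M.measurable_g_left y).ennreal_ofReal hF]
  rfl

lemma update_univ_le_one (y : Y) (μ : Measure X) : M.update y μ Set.univ ≤ 1 := by
  rw [← lintegral_one, M.lintegral_update y μ measurable_const]
  simp

lemma measurable_update {y : α → Y} (hy : Measurable y) {μ : α → Measure X}
    (hμ : ∀ F : α → X → ℝ≥0∞, Measurable (Function.uncurry F) →
      Measurable fun a => ∫⁻ x, F a x ∂μ a) :
    Measurable fun a => M.update (y a) (μ a) := by
  have hg : Measurable (Function.uncurry fun a x => ENNReal.ofReal (M.g x (y a))) :=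
    (M.measurable_g.comp (measurable_snd.prodMk (hy.comp measurable_fst))).ennreal_ofReal
  refine Measure.measurable_of_measurable_coe _ fun A hA => ?_
  have hA' : Measurable (A.indicator (1 : X → ℝ≥0∞)) := measurable_one.indicator hA
  simp_rw [← lintegral_indicator_one hA, M.lintegral_update _ _ hA']
  exact (hμ _ hg).inv.mul (hμ _ (hg.mul (hA'.comp measurable_snd)))

lemma measurable_lintegral_bind_lkh (χ : Measure X) [SFinite χ] (n : ℕ)
    (F : (ℕ → Y) → X → ℝ≥0∞) (hF : Measurable (Function.uncurry F)) :
    Measurable fun y => ∫⁻ x, F y x ∂(χ.bind (M.lkh y 0 n)) := by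
  induction n generalizing F with
  | zero =>
    simp only [lkh, Measure.id_comp]
    exact hF.lintegral_prod_right
  | succ n ih =>
    have hg : Measurable fun q : (ℕ → Y) × X => ENNReal.ofReal (M.g q.2 (q.1 n)) :=
      (M.measurable_g.comp
        (measurable_snd.prodMk ((measurable_pi_apply n).comp measurable_fst))).ennreal_ofReal
    have hQF : Measurable fun q : (ℕ → Y) × X => ∫⁻ x, F q.1 x ∂M.Q q.2 := by
      have := Measurable.lintegral_kernel_prod_right'
        (κ := M.Q.comap (Prod.snd : (ℕ → Y) × X → X) measurable_snd)
        (f := fun q => F q.1.1 q.2) (hF.comp (measurable_fst.fst.prodMk measurable_snd))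
      simpa only [Kernel.comap_apply] using this
    have step (y : ℕ → Y) : ∫⁻ x, F y x ∂(χ.bind (M.lkh y 0 (n + 1))) =
        ∫⁻ x, ENNReal.ofReal (M.g x (y n)) * ∫⁻ x', F y x' ∂M.Q x ∂(χ.bind (M.lkh y 0 n)) := by
      have hFy : Measurable (F y) := hF.comp measurable_prodMk_left
      rw [bind_lkh_succ, Measure.lintegral_bind (Kernel.aemeasurable _) hFy.aemeasurable]
      simp only [stepKernel_apply, lintegral_smul_measure, smul_eq_mul]
    simp_rw [step]
    exact ih _ (hg.mul hQF)

lemma measurable_filt (χ : Measure X) [SFinite χ] (n : ℕ) :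
    Measurable fun y : ℕ → Y => M.filt χ y n := by
  refine M.measurable_update (measurable_pi_apply n) fun F hF => ?_
  have eq_mul (y : ℕ → Y) : ∫⁻ x, F y x ∂M.pred χ y n =
      (∫⁻ _, 1 ∂(χ.bind (M.lkh y 0 n)))⁻¹ * ∫⁻ x, F y x ∂(χ.bind (M.lkh y 0 n)) := by
    rw [pred, lintegral_smul_measure, lintegral_one, smul_eq_mul]
  rw [funext eq_mul]
  exact (M.measurable_lintegral_bind_lkh χ n _ measurable_const).inv.mul
    (M.measurable_lintegral_bind_lkh χ n F hF)

/-- The filter at time `n` as a kernel. It is the zero measure when its normalizing constant is zero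
or infinite. -/
noncomputable def filtKernel (χ : Measure X) [SFinite χ] (n : ℕ) : Kernel (ℕ → Y) X :=
  ⟨fun y => M.filt χ y n, M.measurable_filt χ n⟩

instance (χ : Measure X) [SFinite χ] (n : ℕ) : IsFiniteKernel (M.filtKernel χ n) :=
  ⟨1, ENNReal.one_lt_top, fun y => M.update_univ_le_one (y n) (M.pred χ y n)⟩

lemma lkh_congr (n : ℕ) {y y' : ℕ → Y} (h : ∀ k < n, y k = y' k) :
    M.lkh y 0 n = M.lkh y' 0 n := by
  induction n with
  | zero => rfl
  | succ n ih =>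
    rw [lkh_succ M y n.zero_le, lkh_succ M y' n.zero_le, h n n.lt_succ_self,
      ih fun k hk => h k (hk.trans n.lt_succ_self)]

lemma filt_congr (χ : Measure X) (n : ℕ) {y y' : ℕ → Y} (h : ∀ k ≤ n, y k = y' k) :
    M.filt χ y n = M.filt χ y' n := by
  rw [filt, filt, pred, pred, M.lkh_congr n fun k hk => h k hk.le, h n le_rfl]

lemma measurable_partFilt (N : ℕ) :
    Measurable fun q : Y × (Fin N → X) => M.partFilt q.1 q.2 := by
  refine M.measurable_update measurable_fst fun F hF => ?_
  have eq_sum (q : Y × (Fin N → X)) :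
      ∫⁻ x, F q x ∂empirical q.2 = (N : ℝ≥0∞)⁻¹ * ∑ i, F q (q.2 i) :=
    lintegral_empirical (hF.comp measurable_prodMk_left) q.2
  rw [funext eq_sum]
  exact (Finset.measurable_fun_sum _ fun i _ => hF.comp
    (measurable_id.prodMk ((measurable_pi_apply i).comp measurable_snd))).const_mul _

end Measurability

section ParticleKernel

/-- The particle filter approximation as a kernel. It is the zero measure when all particles have
weight zero. -/
noncomputable def partFiltKernel (N : ℕ) : Kernel (Y × (Fin N → X)) X :=
  ⟨fun q => M.partFilt q.1 q.2, M.measurable_partFilt N⟩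

instance (N : ℕ) : IsFiniteKernel (M.partFiltKernel N) :=
  ⟨1, ENNReal.one_lt_top, fun q => M.update_univ_le_one q.1 (empirical q.2)⟩

lemma bddMeasurable_integral_partFilt (N : ℕ) (y : Y) {f : X → ℝ} (hf : BddMeasurable f) :
    BddMeasurable fun x : Fin N → X => ∫ z, f z ∂M.partFilt y x :=
  hf.kernel_integral ((M.partFiltKernel N).sectR y)

/-- The law of a new particle, given the current observation and the current particles. -/
noncomputable def samplingKernel (N : ℕ) : Kernel (Y × (Fin N → X)) X :=
  M.Q ∘ₖ M.partFiltKernel N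

instance (N : ℕ) : IsFiniteKernel (M.samplingKernel N) :=
  inferInstanceAs (IsFiniteKernel (M.Q ∘ₖ M.partFiltKernel N))

lemma samplingKernel_apply {N : ℕ} (q : Y × (Fin N → X)) :
    M.samplingKernel N q = M.feynmanKac q.1 (empirical q.2) :=
  Kernel.comp_apply ..

/-- The joint law of the `N` particles at each time, given the sequence of observations. -/
noncomputable def particleKernel (χ : Measure X) [IsFiniteMeasure χ] (N : ℕ) :
    ℕ → Kernel (ℕ → Y) (Fin N → X)
  | 0 => iidKernel (Kernel.const _ χ) (Fin N)
  | n + 1 => (particleKernel χ N n ⊗ₖ iidKernel ((M.samplingKernel N).comap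
      (fun q : (ℕ → Y) × (Fin N → X) => (q.1 n, q.2)) (by fun_prop)) (Fin N)).snd

variable (χ : Measure X) [IsProbabilityMeasure χ] (N : ℕ)

instance (n : ℕ) : IsFiniteKernel (M.particleKernel χ N n) := by
  induction n with
  | zero => exact inferInstanceAs (IsFiniteKernel (iidKernel _ _))
  | succ n ih =>
    rw [particleKernel]
    infer_instance

lemma particleKernel_succ_apply (n : ℕ) (y : ℕ → Y) :
    M.particleKernel χ N (n + 1) y =
      (M.particleKernel χ N n y ⊗ₘ
        iidKernel ((M.samplingKernel N).sectR (y n)) (Fin N)).snd := by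
  rw [particleKernel, Kernel.snd_apply, Kernel.compProd_apply_eq_compProd_sectR]
  rfl

lemma particleKernel_congr (n : ℕ) {y y' : ℕ → Y} (h : ∀ k < n, y k = y' k) :
    M.particleKernel χ N n y = M.particleKernel χ N n y' := by
  induction n with
  | zero => rfl
  | succ n ih =>
    rw [particleKernel_succ_apply, particleKernel_succ_apply, h n n.lt_succ_self,
      ih fun k hk => h k (hk.trans n.lt_succ_self)]

variable [NeZero N]

instance (y : Y) [M.RegularObs y] (x : Fin N → X) : IsProbabilityMeasure (M.partFilt y x) :=
  inferInstanceAs (IsProbabilityMeasure (M.update y (empirical x)))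

instance (y : Y) [M.RegularObs y] : IsMarkovKernel ((M.samplingKernel N).sectR y) := by
  refine ⟨fun x => ?_⟩
  rw [Kernel.sectR_apply, samplingKernel_apply]
  infer_instance

instance (y : ℕ → Y) [∀ k, M.RegularObs (y k)] (n : ℕ) :
    IsProbabilityMeasure (M.particleKernel χ N n y) := by
  induction n with
  | zero => exact inferInstanceAs (IsProbabilityMeasure (Measure.pi fun _ => χ))
  | succ n ih =>
    rw [particleKernel_succ_apply]
    infer_instance

end ParticleKernel

end HiddenMarkovModel

section GaussianApproximation

open HiddenMarkovModel (empirical)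
open scoped Real

variable {X : Type*} [MeasurableSpace X]

/-- Samples of `N + 1` points with law `ρ N` are, after integration of bounded measurable functions,
a Gaussian approximation of `ν` at the rate `√N` and with asymptotic variance `V`. -/
structure IsGaussianApprox (ρ : ∀ N, Measure (Fin (N + 1) → X)) (ν : Measure X)
    (V : (X → ℝ) → ℝ) : Prop where
  hasBddExpMoments {f : X → ℝ} (hf : BddMeasurable f) : HasBddExpMoments ρ fun _ => empErr ν f
  isAsympNormal {f : X → ℝ} (hf : BddMeasurable f) : IsAsympNormal ρ (fun _ => empErr ν f) (V f)

lemma isGaussianApprox_pi (χ : Measure X) [IsProbabilityMeasure χ] :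
    IsGaussianApprox (fun N => Measure.pi fun _ : Fin (N + 1) => χ) χ fun f => Var[f; χ] where
  hasBddExpMoments hf s := by
    obtain ⟨C, hC⟩ := hf.bounded
    exact ⟨2 * rexp (C ^ 2 * s ^ 2 / 2), fun N =>
      ⟨((hf.empErr χ).abs.const_mul s).exp.integrable _,
        integral_exp_mul_abs_empErr_le χ hf.measurable hC s⟩⟩
  isAsympNormal {f} hf t := by
    obtain ⟨B, hB⟩ := norm_integral_cexp_empErr_sub_exp_le hf t
    refine tendsto_iff_norm_sub_tendsto_zero.2 <|
      squeeze_zero (fun _ => norm_nonneg _) (fun N => ?_) (tendsto_div_sqrt_add_one B)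
    simpa using hB (N + 1) χ Var[f; χ] (variance_nonneg f χ)

end GaussianApproximation

namespace HiddenMarkovModel

open scoped Real

variable {X Y : Type*} [MeasurableSpace X] [MeasurableSpace Y] (M : HiddenMarkovModel X Y)

/-- The rescaled error made by updating the empirical measure of a sample instead of `ν`. -/
noncomputable def filtErr {N : ℕ} (y : Y) (ν : Measure X) (f : X → ℝ) (x : Fin N → X) : ℝ :=
  √N * (∫ z, f z ∂M.partFilt y x - ∫ z, f z ∂M.update y ν)

lemma bddMeasurable_filtErr (N : ℕ) (y : Y) (ν : Measure X) {f : X → ℝ} (hf : BddMeasurable f) :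
    BddMeasurable (M.filtErr (N := N) y ν f) :=
  ((M.bddMeasurable_integral_partFilt N y hf).sub (.const _)).const_mul _

section FilterError

variable (y : Y) [M.RegularObs y] (ν : Measure X) [IsProbabilityMeasure ν] {N : ℕ} [NeZero N]
  {f : X → ℝ}

lemma integral_g_mul_filtErr (hf : BddMeasurable f) (x : Fin N → X) :
    (∫ z, M.g z y ∂ν) * M.filtErr y ν f x =
      empErr ν (fun z => M.g z y * (f z - ∫ z', f z' ∂M.update y ν)) x -
        empErr ν (fun z => M.g z y) x * M.filtErr y ν f x / √N := by
  have hg := M.bddMeasurable_g y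
  have hN : √(N : ℝ) ≠ 0 := (Real.sqrt_pos.2 (mod_cast Nat.pos_of_neZero N)).ne'
  have mass_pos := M.integral_g_pos y (empirical x)
  have empirical_eq (c : ℝ) : ∫ z, M.g z y * (f z - c) ∂empirical x =
      (∫ z, M.g z y ∂empirical x) * (∫ z, f z ∂M.partFilt y x - c) := by
    simp_rw [mul_sub]
    rw [integral_sub ((hg.mul hf).integrable _) ((hg.integrable _).mul_const _),
      integral_mul_const, partFilt, integral_update, mul_div_cancel₀ _ mass_pos.ne']
  rw [empErr, empErr, filtErr, empirical_eq, M.integral_g_mul_sub_update y ν hf]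
  field_simp
  ring

lemma abs_filtErr_le (hf : BddMeasurable f) {C : ℝ} (hC : ∀ x, |f x| ≤ C) (x : Fin N → X) :
    |M.filtErr y ν f x| ≤ (∫ z, M.g z y ∂ν)⁻¹ *
        |empErr ν (fun z => M.g z y * (f z - ∫ z', f z' ∂M.update y ν)) x| +
      (∫ z, M.g z y ∂ν)⁻¹ * (2 * C) * |empErr ν (fun z => M.g z y) x| := by
  have hpos := M.integral_g_pos y ν
  have hN : 0 < √(N : ℝ) := Real.sqrt_pos.2 (mod_cast Nat.pos_of_neZero N)
  have filtErr_div_le : |M.filtErr y ν f x / √N| ≤ 2 * C := by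
    rw [filtErr, mul_div_cancel_left₀ _ hN.ne']
    refine (abs_sub _ _).trans ?_
    rw [two_mul]
    exact add_le_add (abs_integral_le_of_forall_abs_le hC _)
      (abs_integral_le_of_forall_abs_le hC _)
  rw [mul_assoc, ← mul_add, le_inv_mul_iff₀ hpos]
  calc (∫ z, M.g z y ∂ν) * |M.filtErr y ν f x|
      = |(∫ z, M.g z y ∂ν) * M.filtErr y ν f x| := by rw [abs_mul, abs_of_pos hpos]
    _ ≤ _ := by
      rw [M.integral_g_mul_filtErr y ν hf, mul_div_assoc]
      refine (abs_sub _ _).trans ?_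
      rw [abs_mul, mul_comm |empErr ν (fun z => M.g z y) x|]
      gcongr

end FilterError

section Resampling

variable (y : Y) [M.RegularObs y] {ν : Measure X} [IsProbabilityMeasure ν]
  {ρ : ∀ N, Measure (Fin (N + 1) → X)} {V : (X → ℝ) → ℝ} {f : X → ℝ}

lemma hasBddExpMoments_filtErr (h : IsGaussianApprox ρ ν V) (hf : BddMeasurable f) :
    HasBddExpMoments ρ fun _ => M.filtErr y ν f := by
  have hg := M.bddMeasurable_g y
  obtain ⟨C, hC⟩ := hf.bounded
  exact (h.hasBddExpMoments (hg.mul (hf.sub (.const _)))).of_abs_le_add (h.hasBddExpMoments hg)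
    (fun N => (M.bddMeasurable_filtErr _ y ν hf).measurable.aemeasurable)
    fun N => M.abs_filtErr_le y ν hf hC

/-- The conditional variance of a resampled particle concentrates, because updating and `Q` are
applied to an approximation of `ν`. -/
lemma tendsto_integral_abs_variance_sub (h : IsGaussianApprox ρ ν V) (hf : BddMeasurable f) :
    Tendsto (fun N => ∫ x, |Var[f; (M.samplingKernel (N + 1)).sectR y x] -
      Var[f; M.feynmanKac y ν]| ∂ρ N) atTop (𝓝 0) := by
  have hQ := hf.kernel_integral M.Q
  have hQ2 := (hf.pow 2).kernel_integral M.Q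
  obtain ⟨C, hC⟩ := hQ.bounded
  let Qf : X → ℝ := fun x => ∫ x', f x' ∂M.Q x
  let U (N : ℕ) (x : Fin (N + 1) → X) : ℝ :=
    M.filtErr y ν (fun x => ∫ x', f x' ^ 2 ∂M.Q x) x -
      (∫ z, Qf z ∂M.partFilt y x + ∫ z, Qf z ∂M.update y ν) * M.filtErr y ν Qf x
  have variance_sub (N : ℕ) (x : Fin (N + 1) → X) :
      Var[f; (M.samplingKernel (N + 1)).sectR y x] - Var[f; M.feynmanKac y ν] =
        U N x / √(N + 1 : ℕ) := by
    simp only [Kernel.sectR_apply, samplingKernel_apply, hf.variance_eq,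
      M.integral_feynmanKac y _ hf, M.integral_feynmanKac y _ (hf.pow 2), U, filtErr, partFilt]
    field_simp
    ring
  have U_le (N : ℕ) (x : Fin (N + 1) → X) : |U N x| ≤
      1 * |M.filtErr y ν (fun x => ∫ x', f x' ^ 2 ∂M.Q x) x| + (C + C) * |M.filtErr y ν Qf x| := by
    rw [one_mul]
    refine (abs_sub _ _).trans ?_
    rw [abs_mul]
    gcongr
    exact (abs_add_le _ _).trans (add_le_add (abs_integral_le_of_forall_abs_le hC _)
      (abs_integral_le_of_forall_abs_le hC _))
  have hU (N : ℕ) : AEMeasurable (U N) (ρ N) :=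
    ((M.bddMeasurable_filtErr _ y ν hQ2).sub (((M.bddMeasurable_integral_partFilt _ y hQ).add
      (.const _)).mul (M.bddMeasurable_filtErr _ y ν hQ))).measurable.aemeasurable
  simp_rw [variance_sub]
  exact ((M.hasBddExpMoments_filtErr y h hQ2).of_abs_le_add (M.hasBddExpMoments_filtErr y h hQ)
    hU U_le).tendsto_integral_abs_div_sqrt hU

variable [∀ N, IsProbabilityMeasure (ρ N)]

lemma isAsympNormal_filtErr (h : IsGaussianApprox ρ ν V) (hf : BddMeasurable f) :
    IsAsympNormal ρ (fun _ => M.filtErr y ν f)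
      (V (fun x => M.g x y * (f x - ∫ x', f x' ∂M.update y ν)) / (∫ x, M.g x y ∂ν) ^ 2) := by
  have hg := M.bddMeasurable_g y
  have hpos := M.integral_g_pos y ν
  have hG : BddMeasurable fun x => M.g x y * (f x - ∫ x', f x' ∂M.update y ν) :=
    hg.mul (hf.sub (.const _))
  have herr (N : ℕ) := M.bddMeasurable_filtErr (N + 1) y ν hf
  have hlin (N : ℕ) := (hG.empErr (N := N + 1) ν).const_mul (∫ x, M.g x y ∂ν)⁻¹
  have negligible := ((h.hasBddExpMoments hg).tendsto_integral_abs_mul_div_sqrt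
    (M.hasBddExpMoments_filtErr y h hf) (fun N => (hg.empErr ν).measurable.aemeasurable)
    fun N => (herr N).measurable.aemeasurable).const_mul (∫ x, M.g x y ∂ν)⁻¹
  rw [mul_zero] at negligible
  rw [div_eq_inv_mul, ← inv_pow]
  refine ((h.isAsympNormal hG).const_mul _).of_tendsto_integral_abs_sub
    (fun N => (hlin N).measurable.aemeasurable) (fun N => (herr N).measurable.aemeasurable)
    (fun N => ((herr N).sub (hlin N)).integrable _) (negligible.congr fun N => ?_)
  have filtErr_sub (x : Fin (N + 1) → X) : M.filtErr y ν f x - (∫ x, M.g x y ∂ν)⁻¹ *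
      empErr ν (fun x => M.g x y * (f x - ∫ x', f x' ∂M.update y ν)) x =
        -((∫ x, M.g x y ∂ν)⁻¹ *
          (empErr ν (fun x => M.g x y) x * M.filtErr y ν f x / √(N + 1 : ℕ))) := by
    linear_combination (∫ x, M.g x y ∂ν)⁻¹ * M.integral_g_mul_filtErr y ν hf x -
      M.filtErr y ν f x * inv_mul_cancel₀ hpos.ne'
  simp_rw [filtErr_sub, abs_neg, abs_mul (∫ x, M.g x y ∂ν)⁻¹, abs_of_pos (inv_pos.2 hpos)]
  rw [integral_const_mul]

lemma isGaussianApprox_resample (h : IsGaussianApprox ρ ν V) :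
    IsGaussianApprox
      (fun N => (ρ N ⊗ₘ iidKernel ((M.samplingKernel (N + 1)).sectR y) (Fin (N + 1))).snd)
      (M.feynmanKac y ν) fun f => V (fun x => M.g x y *
        (∫ x', f x' ∂M.Q x - ∫ x', ∫ x'', f x'' ∂M.Q x' ∂M.update y ν)) /
          (∫ x, M.g x y ∂ν) ^ 2 + Var[f; M.feynmanKac y ν] := by
  have empErr_eq {f : X → ℝ} (hf : BddMeasurable f) (N : ℕ)
      (q : (Fin (N + 1) → X) × (Fin (N + 1) → X)) : empErr (M.feynmanKac y ν) f q.2 =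
        M.filtErr y ν (fun x => ∫ x', f x' ∂M.Q x) q.1 +
          condEmpErr ((M.samplingKernel (N + 1)).sectR y) f q := by
    have kernel_eq : ∫ z, f z ∂(M.samplingKernel (N + 1)).sectR y q.1 =
        ∫ z, ∫ z', f z' ∂M.Q z ∂M.partFilt y q.1 := by
      rw [Kernel.sectR_apply, samplingKernel_apply, M.integral_feynmanKac y _ hf, partFilt]
    rw [empErr, condEmpErr, empErr, filtErr, M.integral_feynmanKac y ν hf, kernel_eq]
    ring
  constructor
  · intro f hf
    refine HasBddExpMoments.map ?_ (fun N => measurable_snd) fun N => (hf.empErr _).measurable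
    refine (M.hasBddExpMoments_filtErr y h (hf.kernel_integral M.Q)).comp_fst.of_abs_le_add
      (HasBddExpMoments.condEmpErr ρ _ hf) (a := 1) (b := 1)
      (fun N => ((hf.empErr _).comp measurable_snd).measurable.aemeasurable) fun N q => ?_
    rw [empErr_eq hf, one_mul, one_mul]
    exact abs_add_le _ _
  · intro f hf
    refine IsAsympNormal.map ?_ (fun N => measurable_snd) fun N => (hf.empErr _).measurable
    simp_rw [empErr_eq hf]
    exact (M.isAsympNormal_filtErr y h (hf.kernel_integral M.Q)).add_condEmpErr
      (fun N => (M.bddMeasurable_filtErr _ y ν (hf.kernel_integral M.Q)).measurable) hf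
      (variance_nonneg f _) (M.tendsto_integral_abs_variance_sub y h hf)

end Resampling

section ParticleFilter

variable (χ : Measure X) [IsProbabilityMeasure χ] (y : ℕ → Y) [∀ k, M.RegularObs (y k)]

lemma isGaussianApprox_particleKernel (n : ℕ) :
    IsGaussianApprox (fun N => M.particleKernel χ (N + 1) n y) (M.pred χ y n)
      (M.predVariance χ y n) := by
  induction n with
  | zero =>
    have h := isGaussianApprox_pi χ
    rw [pred_zero]
    exact ⟨h.hasBddExpMoments, fun hf => by
      rw [M.predVariance_zero χ y hf.measurable]
      exact h.isAsympNormal hf⟩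
  | succ n ih =>
    have h := M.isGaussianApprox_resample (y n) ih
    simp_rw [particleKernel_succ_apply, pred_succ]
    refine ⟨h.hasBddExpMoments, fun hf => ?_⟩
    rw [M.predVariance_succ χ y n hf, pred_succ, add_comm]
    exact h.isAsympNormal hf

lemma tendsto_integral_abs_filtErr_rpow {f : X → ℝ} (hf : BddMeasurable f) {p : ℝ} (hp : 0 < p)
    (n : ℕ) :
    Tendsto (fun N => ∫ x, |M.filtErr (y n) (M.pred χ y n) f x| ^ p
        ∂M.particleKernel χ (N + 1) n y) atTop
      (𝓝 ((2 * M.filtVariance χ y n f) ^ (p / 2) * (Real.Gamma ((p + 1) / 2) / √π))) := by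
  have h := M.isGaussianApprox_particleKernel χ y n
  exact (M.isAsympNormal_filtErr (y n) h hf).tendsto_integral_abs_rpow
    (M.hasBddExpMoments_filtErr (y n) h hf)
    (fun N => (M.bddMeasurable_filtErr _ (y n) _ hf).measurable.aemeasurable)
    (M.filtVariance_nonneg χ y n f) hp

lemma tendsto_sqrt_mul_integral_rpow {f : X → ℝ} (hf : BddMeasurable f) {p : ℝ} (hp : 0 < p)
    (n : ℕ) :
    Tendsto (fun N : ℕ => √N * (∫ x, |∫ z, f z ∂M.partFilt (y n) x -
        ∫ z, f z ∂M.filt χ y n| ^ p ∂M.particleKernel χ N n y) ^ (1 / p)) atTop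
      (𝓝 (√2 * √(M.filtVariance χ y n f) * (Real.Gamma ((p + 1) / 2) / √π) ^ (1 / p))) := by
  have hGamma : 0 ≤ Real.Gamma ((p + 1) / 2) / √π :=
    div_nonneg (Real.Gamma_nonneg_of_nonneg (by positivity)) (Real.sqrt_nonneg _)
  have hv := M.filtVariance_nonneg χ y n f
  have limit_eq : ((2 * M.filtVariance χ y n f) ^ (p / 2) *
      (Real.Gamma ((p + 1) / 2) / √π)) ^ (1 / p) =
        √2 * √(M.filtVariance χ y n f) * (Real.Gamma ((p + 1) / 2) / √π) ^ (1 / p) := by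
    rw [Real.mul_rpow (by positivity) hGamma, ← Real.rpow_mul (by positivity),
      ← Real.sqrt_mul zero_le_two, Real.sqrt_eq_rpow (2 * _)]
    congr 2
    field_simp
  rw [← limit_eq, ← tendsto_add_atTop_iff_nat 1]
  refine ((M.tendsto_integral_abs_filtErr_rpow χ y hf hp n).rpow_const
    (.inr (by positivity))).congr fun N => ?_
  simp_rw [filtErr, abs_mul, abs_of_nonneg (Real.sqrt_nonneg _),
    Real.mul_rpow (Real.sqrt_nonneg _) (abs_nonneg _)]
  rw [integral_const_mul, Real.mul_rpow (by positivity)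
    (integral_nonneg fun x => by positivity), ← Real.rpow_mul (Real.sqrt_nonneg _),
    mul_one_div_cancel hp.ne', Real.rpow_one]
  rfl

end ParticleFilter

end HiddenMarkovModel

section ConditionalDistribution

lemma measure_ext_prod_pi {α ι X : Type*} [Finite ι] [MeasurableSpace α] [MeasurableSpace X]
    {μ ν : Measure (α × (ι → X))} [IsFiniteMeasure μ]
    (h : ∀ (B : Set α) (A : ι → Set X), MeasurableSet B → (∀ i, MeasurableSet (A i)) →
      μ (B ×ˢ Set.univ.pi A) = ν (B ×ˢ Set.univ.pi A)) : μ = ν := by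
  have := Fintype.ofFinite ι
  have generate := generateFrom_eq_prod (α := α) (β := ι → X)
    MeasurableSpace.generateFrom_measurableSet
    (generateFrom_pi (α := fun _ : ι => X)) isCountablySpanning_measurableSet
    (IsCountablySpanning.pi fun _ => isCountablySpanning_measurableSet)
  refine ext_of_generate_finite _ generate.symm
    (MeasurableSpace.isPiSystem_measurableSet.prod (isPiSystem_pi (α := fun _ : ι => X))) ?_ ?_
  · rintro _ ⟨B, hB, _, ⟨A, hA, rfl⟩, rfl⟩
    exact h B A hB fun i => hA i (Set.mem_univ i)
  · simpa using h Set.univ (fun _ => Set.univ) .univ fun _ => .univ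

variable {Ω α β γ : Type*} {m m₀ : MeasurableSpace Ω} [MeasurableSpace α] [MeasurableSpace β]
  [MeasurableSpace γ] {P : Measure Ω}

lemma measure_inter_eq_setLIntegral_of_condExp [IsFiniteMeasure P]
    (hm : m ≤ m₀) {s t : Set Ω} (hs : MeasurableSet s) (ht : MeasurableSet[m] t) {φ : Ω → ℝ≥0∞}
    (hφ : ∀ ω, φ ω ≠ ∞)
    (h : P[s.indicator (fun _ => (1 : ℝ)) | m] =ᵐ[P] fun ω => (φ ω).toReal) :
    P (s ∩ t) = ∫⁻ ω in t, φ ω ∂P := by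
  have integrable_φ : Integrable (fun ω => (φ ω).toReal) P := integrable_condExp.congr h
  have real_eq : P.real (s ∩ t) = ∫ ω in t, (φ ω).toReal ∂P := by
    rw [← setIntegral_congr_ae (hm t ht) (h.mono fun _ hω _ => hω),
      setIntegral_condExp hm ((integrable_const (1 : ℝ)).indicator hs) ht,
      setIntegral_indicator hs, setIntegral_const, Set.inter_comm, smul_eq_mul, mul_one]
  rw [← ofReal_measureReal, real_eq, ofReal_integral_eq_lintegral_ofReal integrable_φ.integrableOn
    (ae_of_all _ fun _ => ENNReal.toReal_nonneg)]
  exact lintegral_congr fun ω => ENNReal.ofReal_toReal (hφ ω)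

lemma hasCondDistrib_iidKernel_of_condExp [IsFiniteMeasure P]
    (hm : m ≤ m₀) {ι : Type*} [Fintype ι] {ξ : ι → Ω → β} (hξ : ∀ i, Measurable (ξ i)) {Z : Ω → α}
    (hZ : Measurable[m] Z) {κ : Kernel α β} [IsFiniteKernel κ]
    (h : ∀ A : ι → Set β, (∀ i, MeasurableSet (A i)) →
      P[Set.indicator {ω | ∀ i, ξ i ω ∈ A i} (fun _ => (1 : ℝ)) | m]
        =ᵐ[P] fun ω => ∏ i, (κ (Z ω)).real (A i)) :
    HasCondDistrib (fun ω i => ξ i ω) Z (iidKernel κ ι) P := by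
  have hZ₀ : Measurable Z := hZ.mono hm le_rfl
  have hξZ : Measurable fun ω => (Z ω, fun i => ξ i ω) := hZ₀.prodMk (measurable_pi_lambda _ hξ)
  refine ⟨(hξZ.aemeasurable :), measure_ext_prod_pi fun B A hB hA => ?_⟩
  have hpi : MeasurableSet (Set.univ.pi A) := .univ_pi hA
  have hs : MeasurableSet {ω | ∀ i, ξ i ω ∈ A i} := by
    rw [Set.ofPred_forall]
    exact .iInter fun i => hξ i (hA i)
  have preimage_eq : (fun ω => (Z ω, fun i => ξ i ω)) ⁻¹' (B ×ˢ Set.univ.pi A) =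
      {ω | ∀ i, ξ i ω ∈ A i} ∩ Z ⁻¹' B := by
    ext ω
    simp [and_comm]
  rw [Measure.map_apply hξZ (hB.prod hpi), preimage_eq, Measure.compProd_apply_prod hB hpi,
    setLIntegral_map hB (Kernel.measurable_coe _ hpi) hZ₀]
  refine measure_inter_eq_setLIntegral_of_condExp hm hs (hZ hB) (fun ω => measure_ne_top _ _)
    ((h A hA).trans (ae_of_all _ fun ω => ?_))
  simp [iidKernel_apply, Measure.pi_pi, ENNReal.toReal_prod, Measure.real]

lemma hasCondDistrib_prodMk [IsFiniteMeasure P] {X : Ω → α} {Y : Ω → β} {Z : Ω → γ}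
    {κ : Kernel α β} [IsSFiniteKernel κ] {η : Kernel (α × β) γ} [IsSFiniteKernel η]
    (hY : HasCondDistrib Y X κ P) (hZ : HasCondDistrib Z (fun ω => (X ω, Y ω)) η P) :
    HasCondDistrib (fun ω => (Y ω, Z ω)) X (κ ⊗ₖ η) P := by
  refine ⟨hY.aemeasurable_fst.prodMk (hY.aemeasurable_snd.prodMk hZ.aemeasurable_snd), ?_⟩
  rw [← Measure.compProd_assoc', ← hY.map_eq, ← hZ.map_eq,
    AEMeasurable.map_map_of_aemeasurable (by fun_prop) hZ.aemeasurable]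
  rfl

lemma condExp_comp_prodMk_ae_eq [IsFiniteMeasure P] {Z : Ω → α} (hZ : Measurable Z) {Y : Ω → β}
    {κ : Kernel α β} [IsFiniteKernel κ] (hY : HasCondDistrib Y Z κ P) {Φ : α × β → ℝ}
    (hΦ : BddMeasurable Φ) :
    P[fun ω => Φ (Z ω, Y ω) | MeasurableSpace.comap Z inferInstance] =ᵐ[P]
      fun ω => ∫ b, Φ (Z ω, b) ∂κ (Z ω) := by
  have hψ := hΦ.kernel_integral_prodMk κ
  have hΦZY : Integrable (fun ω => Φ (Z ω, Y ω)) P :=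
    (hΦ.integrable _).comp_aemeasurable hY.aemeasurable
  refine (ae_eq_condExp_of_forall_setIntegral_eq hZ.comap_le hΦZY
    (fun s _ _ => ((hψ.comp hZ).integrable P).integrableOn) ?_ ?_).symm
  · rintro _ ⟨B, hB, rfl⟩ -
    calc ∫ ω in Z ⁻¹' B, ∫ b, Φ (Z ω, b) ∂κ (Z ω) ∂P
        = ∫ z in B, ∫ b, Φ (z, b) ∂κ z ∂(P.map Z) :=
          (setIntegral_map hB hψ.measurable.aestronglyMeasurable hZ.aemeasurable).symm
      _ = ∫ q in B ×ˢ Set.univ, Φ q ∂(P.map fun ω => (Z ω, Y ω)) := by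
          rw [hY.map_eq, Measure.setIntegral_compProd hB .univ (hΦ.integrable _).integrableOn]
          simp only [Measure.restrict_univ]
      _ = ∫ ω in Z ⁻¹' B, Φ (Z ω, Y ω) ∂P := by
          rw [setIntegral_map (hB.prod .univ) hΦ.measurable.aestronglyMeasurable hY.aemeasurable]
          simp [Set.mk_preimage_prod]
  · exact (hψ.measurable.comp (comap_measurable _)).stronglyMeasurable.aestronglyMeasurable

end ConditionalDistribution

section ExtendObs

variable {Y : Type*} {n : ℕ}

/-- An infinite continuation of a finite record of observations. The choice of the continuation is
immaterial for quantities that depend on the observations up to time `n` only. -/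
def extendObs (z : Fin (n + 1) → Y) : ℕ → Y := fun k => z (Fin.ofNat (n + 1) k)

lemma extendObs_apply (y : ℕ → Y) {k : ℕ} (hk : k ≤ n) :
    extendObs (fun i : Fin (n + 1) => y i) k = y k := by
  simp [extendObs, Nat.mod_eq_of_lt (Nat.lt_succ_of_le hk)]

lemma measurable_extendObs [MeasurableSpace Y] :
    Measurable (extendObs : (Fin (n + 1) → Y) → ℕ → Y) :=
  measurable_pi_lambda _ fun _ => measurable_pi_apply _

end ExtendObs

namespace HiddenMarkovModel

variable {X Y Ω : Type*} [MeasurableSpace X] [MeasurableSpace Y] [MeasurableSpace Ω]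
  {M : HiddenMarkovModel X Y} {P : Measure Ω} {obs : ℕ → Ω → Y}

lemma ae_regularObs (hstat : IsStationarySeq P obs) (hA2 : M.LikelihoodAssumption P obs) :
    ∀ᵐ ω ∂P, ∀ k, M.RegularObs (obs k ω) := by
  have ae_sup_ne_top : ∀ᵐ y ∂P.map (obs 0), M.supLikelihood y ≠ ∞ := by
    have log_aemeasurable :=
      (ENNReal.continuous_log.measurable.comp_aemeasurable hA2.aemeasurable_sup).ereal_toENNReal
    filter_upwards [ae_lt_top' log_aemeasurable hA2.lintegral_log_lt_top.ne] with y hy htop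
    simp [htop] at hy
  refine ae_all_iff.2 fun k => ?_
  have map_obs_eq : P.map (obs k) = P.map (obs 0) := by
    have := congrArg (Measure.map fun z : ℕ → Y => z 0) (hstat.shift_eq k)
    rw [Measure.map_map (measurable_pi_apply 0) (measurable_pi_lambda _ fun _ =>
      hstat.measurable_obs _), Measure.map_map (measurable_pi_apply 0)
      (measurable_pi_lambda _ hstat.measurable_obs)] at this
    simpa [Function.comp_def] using this
  rw [← map_obs_eq] at ae_sup_ne_top
  filter_upwards [ae_of_ae_map (hstat.measurable_obs k).aemeasurable ae_sup_ne_top] with ω hω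
  refine ⟨fun x => hA2.pos x _, (M.supLikelihood (obs k ω)).toReal, fun x => ?_⟩
  rw [← ENNReal.toReal_ofReal (M.g_nonneg x (obs k ω))]
  exact ENNReal.toReal_mono hω (le_iSup (fun x => ENNReal.ofReal (M.g x (obs k ω))) x)

lemma IsBootstrapFilter.hasCondDistrib [IsFiniteMeasure P] {χ : Measure X}
    [IsProbabilityMeasure χ] {N : ℕ} {ξ : ℕ → Fin N → Ω → X}
    (hξ : M.IsBootstrapFilter χ P obs N ξ) (hobs : ∀ k, Measurable (obs k)) (n : ℕ) :
    HasCondDistrib (fun ω i => ξ n i ω) (fun ω k => obs k ω) (M.particleKernel χ N n) P := by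
  have hY : Measurable fun ω k => obs k ω := measurable_pi_lambda _ hobs
  have hξm (n : ℕ) : Measurable fun ω i => ξ n i ω :=
    measurable_pi_lambda _ (hξ.measurable_particle n)
  induction n with
  | zero =>
    exact hasCondDistrib_iidKernel_of_condExp hY.comap_le (hξ.measurable_particle 0)
      (comap_measurable _) fun A hA => by simpa only [Kernel.const_apply] using hξ.init A hA
  | succ n ih =>
    refine (hasCondDistrib_prodMk ih (hasCondDistrib_iidKernel_of_condExp
      (sup_le hY.comap_le (measurable_pi_lambda _ fun m : Fin (n + 1) => hξm m).comap_le)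
      (hξ.measurable_particle (n + 1)) ?_ fun A hA => ?_)).snd
    · exact ((comap_measurable _).mono le_sup_left le_rfl).prodMk
        (((measurable_pi_apply (Fin.last n)).comp
          (comap_measurable fun ω (m : Fin (n + 1)) i => ξ m i ω)).mono le_sup_right le_rfl)
    · simpa only [Kernel.comap_apply, samplingKernel_apply] using hξ.step n A hA

variable [IsFiniteMeasure P] {χ : Measure X} [IsProbabilityMeasure χ] {N : ℕ}
  {ξ : ℕ → Fin N → Ω → X}

lemma IsBootstrapFilter.hasCondDistrib_restrict (hξ : M.IsBootstrapFilter χ P obs N ξ)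
    (hobs : ∀ k, Measurable (obs k)) (n : ℕ) :
    HasCondDistrib (fun ω i => ξ n i ω) (fun ω (k : Fin (n + 1)) => obs k ω)
      ((M.particleKernel χ N n).comap extendObs measurable_extendObs) P := by
  have restrict : Measurable fun (y : ℕ → Y) (k : Fin (n + 1)) => y k :=
    measurable_pi_lambda _ fun k => measurable_pi_apply _
  refine HasCondDistrib.comp_right (hf := restrict) (Z := fun ω k => obs k ω) ?_
  convert hξ.hasCondDistrib hobs n using 1
  ext y : 1
  exact M.particleKernel_congr χ N n fun k hk => extendObs_apply y hk.le

lemma IsBootstrapFilter.condExp_abs_rpow_ae_eq (hξ : M.IsBootstrapFilter χ P obs N ξ)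
    (hobs : ∀ k, Measurable (obs k)) {f : X → ℝ} (hf : BddMeasurable f) {p : ℝ} (hp : 0 ≤ p)
    (n : ℕ) :
    P[fun ω => |∫ x, f x ∂M.partFilt (obs n ω) (fun i => ξ n i ω) -
          ∫ x, f x ∂M.filt χ (fun k => obs k ω) n| ^ p |
        MeasurableSpace.comap (fun ω (k : Fin (n + 1)) => obs k ω) inferInstance] =ᵐ[P]
      fun ω => ∫ x, |∫ z, f z ∂M.partFilt (obs n ω) x -
          ∫ z, f z ∂M.filt χ (fun k => obs k ω) n| ^ p
        ∂M.particleKernel χ N n fun k => obs k ω := by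
  have hΦ : BddMeasurable fun q : (Fin (n + 1) → Y) × (Fin N → X) =>
      |∫ x, f x ∂M.partFilt (q.1 (Fin.last n)) q.2 -
        ∫ x, f x ∂M.filt χ (extendObs q.1) n| ^ p :=
    (((hf.kernel_integral (M.partFiltKernel N)).comp (by fun_prop :
      Measurable fun q : (Fin (n + 1) → Y) × (Fin N → X) => (q.1 (Fin.last n), q.2))).sub
      ((hf.kernel_integral (M.filtKernel χ n)).comp
        (measurable_extendObs.comp measurable_fst))).abs_rpow hp
  have filt_eq (ω : Ω) : M.filt χ (extendObs fun k : Fin (n + 1) => obs k ω) n =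
      M.filt χ (fun k => obs k ω) n :=
    M.filt_congr χ n fun _ hk => extendObs_apply (fun k => obs k ω) hk
  have particleKernel_eq (ω : Ω) :
      M.particleKernel χ N n (extendObs fun k : Fin (n + 1) => obs k ω) =
        M.particleKernel χ N n fun k => obs k ω :=
    M.particleKernel_congr χ N n fun _ hk => extendObs_apply (fun k => obs k ω) hk.le
  simpa only [filt_eq, particleKernel_eq, Kernel.comap_apply, Fin.val_last] using
    condExp_comp_prodMk_ae_eq (Z := fun ω (k : Fin (n + 1)) => obs k ω)
      (measurable_pi_lambda _ fun k => hobs k) (hξ.hasCondDistrib_restrict hobs n) hΦ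

end HiddenMarkovModel

theorem mainTheorem4_general {X Y Ω : Type*} [MeasurableSpace X] [MeasurableSpace Y]
    [MeasurableSpace Ω] (P : Measure Ω) [IsProbabilityMeasure P] (M : HiddenMarkovModel X Y)
    (obs : ℕ → Ω → Y) (hobs : ∀ k, Measurable (obs k))
    (hreg : ∀ᵐ ω ∂P, ∀ k, M.RegularObs (obs k ω))
    (χ : Measure X) [IsProbabilityMeasure χ]
    (ξ : (N : ℕ) → ℕ → Fin N → Ω → X)
    (hξ : ∀ N, 0 < N → M.IsBootstrapFilter χ P obs N (ξ N))
    (h : X → ℝ) (h_meas : Measurable h) (h_bdd : ∃ C, ∀ x, |h x| ≤ C)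
    (p : ℝ) (hp : 0 < p) (n : ℕ) :
    ∀ᵐ ω ∂P, Tendsto
      (fun N : ℕ => √(N : ℝ) *
        ((P[fun ω' => |(∫ x, h x ∂(M.partFilt (obs n ω') (fun i => ξ N n i ω'))) -
              ∫ x, h x ∂(M.filt χ (fun k => obs k ω') n)| ^ p |
            MeasurableSpace.comap (fun ω' (k : Fin (n + 1)) => obs k ω') inferInstance]) ω)
          ^ (1 / p))
      atTop
      (𝓝 (√2 * √(M.filtVariance χ (fun k => obs k ω) n h) *
        (Real.Gamma ((p + 1) / 2) / √Real.pi) ^ (1 / p))) := by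
  have hh : BddMeasurable h := ⟨h_meas, h_bdd⟩
  have condExp_eq := ae_all_iff.2 fun N : {N : ℕ // 0 < N} =>
    (hξ N N.2).condExp_abs_rpow_ae_eq hobs hh hp.le n
  filter_upwards [hreg, condExp_eq] with ω hω condExp_eq
  refine (M.tendsto_sqrt_mul_integral_rpow χ (fun k => obs k ω) hh hp n).congr' ?_
  filter_upwards [eventually_gt_atTop 0] with N hN
  rw [condExp_eq ⟨N, hN⟩]

theorem mainTheorem4 {X Y Ω : Type*} [MeasurableSpace X] [MeasurableSpace.CountablyGenerated X]
    [MeasurableSpace Y] [MeasurableSpace Ω] (P : Measure Ω) [IsProbabilityMeasure P]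
    (M : HiddenMarkovModel X Y)
    (obs : ℕ → Ω → Y) (hstat : IsStationarySeq P obs)
    (hA2 : M.LikelihoodAssumption P obs)
    (χ : Measure X) [IsProbabilityMeasure χ]
    (ξ : (N : ℕ) → ℕ → Fin N → Ω → X)
    (hξ : ∀ N, 0 < N → M.IsBootstrapFilter χ P obs N (ξ N))
    (h : X → ℝ) (h_meas : Measurable h) (h_bdd : ∃ C, ∀ x, |h x| ≤ C)
    (p : ℝ) (hp : 0 < p) (n : ℕ) :
    ∀ᵐ ω ∂P, Tendsto
      (fun N : ℕ => √(N : ℝ) *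
        ((P[fun ω' => |(∫ x, h x ∂(M.partFilt (obs n ω') (fun i => ξ N n i ω'))) -
              ∫ x, h x ∂(M.filt χ (fun k => obs k ω') n)| ^ p |
            MeasurableSpace.comap (fun ω' (k : Fin (n + 1)) => obs k ω') inferInstance]) ω)
          ^ (1 / p))
      atTop
      (𝓝 (√2 * √(M.filtVariance χ (fun k => obs k ω) n h) *
        (Real.Gamma ((p + 1) / 2) / √Real.pi) ^ (1 / p))) :=
  mainTheorem4_general P M obs hstat.measurable_obs (HiddenMarkovModel.ae_regularObs hstat hA2) χ ξ
    hξ h h_meas h_bdd p hp n
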